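/- Let $\mathbb{S}\subset\mathbb{R}^3$ be the unit sphere with surface area measure $\sigma$, and let $Y_1,Y_2,\ldots$ be iid on $\mathbb{S}$ with density $f^\star$ with respect to $\sigma$. Let $k(y\mid x)\ge 0$ be a jointly measurable kernel on $\mathbb{S}\times\mathbb{S}$, let $w_1,w_2,\ldots\in(0,1)$, and let $\Psi_0$ be a probability measure on $\mathbb{S}$ with support $\mathbb{X}$ (for instance $\mathbb{X}=\mathbb{S}$). For a mixing distribution $\Psi$, that is, a probability measure $\Psi$ on $\mathbb{S}$ with $\Psi(\mathbb{X})=1$, put $f_\Psi(y)=\int k(y\mid x)\,\Psi(dx)$. The predictive recursion (PR) estimates are given by \[ \Psi_i(dx)=(1-w_i)\,\Psi_{i-1}(dx)+w_i\,\frac{k(Y_i\mid x)\,\Psi_{i-1}(dx)}{f_{i-1}(Y_i)},\qquad f_i=f_{\Psi_i}. \] Write $K(f,g)=\int f\log(f/g)\,d\sigma$ for the Kullback--Leibler divergence. Assume that (a) $\int k(y\mid x)\,\sigma(dy)=1$ for every $x\in\mathbb{X}$, and $x\mapsto k(y\mid x)$ is continuous (hence bounded) on $\mathbb{X}$ for every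 $y$; (b) for every $x\in\mathbb{X}$, $k(y\mid x)>0$ for $f^\star$-almost every $y$, and \[ \sup_{x_1,x_2\in\mathbb{X}}\int\Bigl\{\frac{k(y\mid x_1)}{k(y\mid x_2)}\Bigr\}^2 f^\star(y)\,\sigma(dy)<\infty; \] (c) $\sum_i w_i=\infty$ and $\sum_i w_i^2<\infty$. The density $f^\star$ need not be of the form $f_\Psi$. Then the following hold. 1. Almost surely, $K(f^\star,f_n)\to\inf_\Psi K(f^\star,f_\Psi)$, where the infimum is over all mixing distributions $\Psi$. If $f^\star=f_\Psi$ $\sigma$-almost everywhere for some mixing distribution $\Psi$ (correct specification), then the infimum is $0$ and $f_n$ is consistent: almost surely $K(f^\star,f_n)\to 0$ and $\int|f_n-f^\star|\,d\sigma\to 0$. 2. Suppose that the infimum in 1 is finite and that the mixture model is identifiable on the support of the data, that is, $f_\Psi=f_{\Psi'}$ $f^\star$-almost everywhere implies $\Psi=\Psi'$ (if $f^\star>0$ $\sigma$-almost everywhere, this is identifiability in the usual sense). Then there is a unique mixing distribution $\Psi^\star$ that attains the infimum, and almost surely $\Psi_n\to\Psi^\star$ weakly. If the model is correctly specified, $f^\star=f_{\Psi^\star}$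 $\sigma$-almost everywhere, then identifiability in the usual sense ($f_\Psi=f_{\Psi'}$ $\sigma$-almost everywhere implies $\Psi=\Psi'$) suffices: the true mixing distribution $\Psi^\star$ is the unique minimiser, and almost surely $\Psi_n\to\Psi^\star$ weakly. -/

import Mathlib

open MeasureTheory ProbabilityTheory Filter Topology
open scoped ENNReal NNReal

/-- The unit sphere in three-dimensional Euclidean space. -/
abbrev S2 : Type := Metric.sphere (0 : EuclideanSpace ℝ (Fin 3)) 1

/-- The surface area measure `σ` on the unit sphere (total mass `4π`). -/
noncomputable def surf : Measure S2 := (volume : Measure (EuclideanSpace ℝ (Fin 3))).toSphere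

/-- The mixing distributions: the probability measures on the sphere carried by the
closed set `X`. -/
def mixing (X : Set S2) : Set (ProbabilityMeasure S2) := {Ψ | (Ψ : Measure S2) Xᶜ = 0}

/-- The mixture density `f_Ψ(y) = ∫ k(y ∣ x) Ψ(dx)`; here `k y x` stands for `k(y ∣ x)`. -/
noncomputable def mixture (k : S2 → S2 → ℝ≥0) (Ψ : Measure S2) (y : S2) : ℝ≥0∞ :=
  ∫⁻ x, (k y x : ℝ≥0∞) ∂Ψ

/-- The distribution with density `f` with respect to the surface area measure. -/
noncomputable def law (f : S2 → ℝ≥0∞) : Measure S2 := surf.withDensity f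

/-- The Kullback-Leibler divergence `K(f, g) = ∫ log (f / g) f dσ` of `g` from `f`,
for densities `f`, `g` with respect to the surface area measure. -/
noncomputable def KL (f g : S2 → ℝ≥0∞) : ℝ≥0∞ := InformationTheory.klDiv (law f) (law g)

/-- The infimum of `K(f, f_Ψ)` over all mixing distributions `Ψ` on `X`. -/
noncomputable def infKL (k : S2 → S2 → ℝ≥0) (X : Set S2) (f : S2 → ℝ≥0∞) : ℝ≥0∞ :=
  ⨅ Ψ ∈ mixing X, KL f (mixture k (Ψ : Measure S2))

/-- `Ψ` is the only mixing distribution on `X` at which `K(f, f_Ψ)` attains its infimum. -/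
def IsUniqueMinimizer (k : S2 → S2 → ℝ≥0) (X : Set S2) (f : S2 → ℝ≥0∞)
    (Ψ : ProbabilityMeasure S2) : Prop :=
  Ψ ∈ mixing X ∧ KL f (mixture k (Ψ : Measure S2)) = infKL k X f ∧
    ∀ Ψ' ∈ mixing X, KL f (mixture k (Ψ' : Measure S2)) = infKL k X f → Ψ' = Ψ

/-- The mixture model is identifiable modulo `ν`: mixing distributions on `X` whose mixture
densities agree `ν`-almost everywhere are equal. For `ν` the surface area measure this is
identifiability in the usual sense. -/
def Identifiable (k : S2 → S2 → ℝ≥0) (X : Set S2) (ν : Measure S2) : Prop :=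
  ∀ Ψ ∈ mixing X, ∀ Ψ' ∈ mixing X,
    mixture k (Ψ : Measure S2) =ᵐ[ν] mixture k (Ψ' : Measure S2) → Ψ = Ψ'

/-- One update of predictive recursion, with weight `w` and observation `y`:
`(1 - w) Ψ(dx) + w k(y ∣ x) Ψ(dx) / f_Ψ(y)`. -/
noncomputable def prStep (k : S2 → S2 → ℝ≥0) (w : ℝ) (y : S2) (Ψ : Measure S2) : Measure S2 :=
  ENNReal.ofReal (1 - w) • Ψ +
    ENNReal.ofReal w • Ψ.withDensity (fun x => (k y x : ℝ≥0∞) / mixture k Ψ y)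

/-- The predictive recursion estimate `Ψ_n` started at `Ψ₀`. The sequences are indexed from
zero: `w i` and `y i` are the `(i + 1)`-st weight and the `(i + 1)`-st observation. -/
noncomputable def pr (k : S2 → S2 → ℝ≥0) (w : ℕ → ℝ) (Ψ₀ : Measure S2) (y : ℕ → S2) :
    ℕ → Measure S2
  | 0 => Ψ₀
  | n + 1 => prStep k (w n) (y n) (pr k w Ψ₀ y n)

/-- Weak convergence of a sequence of measures, all of which are probability measures, to `Ψ`. -/
def WeaklyTo (Q : ℕ → Measure S2) (Ψ : ProbabilityMeasure S2) : Prop :=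
  ∃ P : ℕ → ProbabilityMeasure S2, (∀ n, (P n : Measure S2) = Q n) ∧ Tendsto P atTop (𝓝 Ψ)

/-! Write ν for the law of the data and `gain` for the ν-mean of log(f_Φ/f_Ψ). If K(f*, f_{Ψ₀}) is
finite, K(f*, f_Φ) is a constant minus the gain of Φ over Ψ₀; otherwise all mixtures have infinite
divergence (`KL_mixture_dichotomy`). So the aim is that the gain L_n of Ψ_n over Ψ₀ tends to its
maximum. Jensen, used twice, carries the moment assumption from kernel ratios to all ratios f_Φ/f_Ψ,
uniformly (`lintegral_mixture_div_sq_le`). Log ratios then have bounded second moments, so gain is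
bounded and, by uniform integrability, continuous.

L_n converges: by a first order lower bound for log(1 - w + wz), one step changes L_n by at least
w_n(D_n - 1) - O(w_n²/(1 - w_n)), where D_n is the ν-mean of the ratio of the posterior mixture to
f_n. Averaged over the new observation, D_n is the second moment under Ψ_n of a function of mean 1,
hence at least 1 (`one_le_lintegral_posterior`). So L_n increases up to a convergent martingale and
a summable error, and it is bounded (`ae_exists_tendsto_gain_pr`).

The limit is the maximum: for Φ ≤ MΨ₀ the Φ-mean of log(dΨ_n/dΨ₀) is at most M (`logDens_le`). Up to
a summable error its increments are at least w_n(f_Φ(Y)/f_n(Y) - 1), Y being the next observation,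
and the ν-mean of the bracket is at least the gain of Φ over Ψ_n. So the partial sums of w_n times
the gap between the gain of Φ over Ψ₀ and L_n are bounded above, and divergence of the weights
yields `ae_le_of_tendsto_gain_pr`. Averaging Ψ₀ over small balls approximates any mixing
distribution by such Φ, and continuity of gain concludes (`ae_tendsto_gain_pr`).

Consistency: gain is weakly continuous on the compact set of mixing distributions, so a maximiser
exists. Strict concavity of log makes its mixture density unique ν-almost everywhere
(`mixture_ae_eq_of_gain_eq`), identifiability makes it unique, and compactness turns convergence of
L_n into weak convergence. L¹ convergence comes from a Pinsker-type bound
(`lintegral_abs_sub_le_KL`). -/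

section General

/-! ### Moment inequalities and uniform integrability. -/

variable {α : Type*} [MeasurableSpace α]

/-- The second moment of a nonnegative function dominates the square of its mean. -/
theorem sq_lintegral_le_lintegral_sq (μ : Measure α) [IsProbabilityMeasure μ] {f : α → ℝ≥0∞}
    (hf : AEMeasurable f μ) : (∫⁻ a, f a ∂μ) ^ 2 ≤ ∫⁻ a, f a ^ 2 ∂μ := by
  have h := ENNReal.lintegral_mul_le_Lp_mul_Lq μ Real.HolderConjugate.two_two hf
    (aemeasurable_const (b := (1 : ℝ≥0∞)))
  simp only [Pi.mul_apply, mul_one, ENNReal.one_rpow, lintegral_const, measure_univ] at h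
  calc (∫⁻ a, f a ∂μ) ^ 2 ≤ ((∫⁻ a, f a ^ (2 : ℝ) ∂μ) ^ (1 / 2 : ℝ)) ^ 2 := by gcongr
    _ = ∫⁻ a, f a ^ 2 ∂μ := by
      rw [← ENNReal.rpow_natCast, ← ENNReal.rpow_mul]
      simp

theorem two_le_div_add_div {a c : ℝ≥0∞} (hc : c ≠ 0) (hc' : c ≠ ∞) (ha : a ≠ ∞) :
    2 ≤ a / c + c / a := by
  rcases eq_or_ne a 0 with rfl | h0
  · simp [ENNReal.div_zero hc]
  · lift a to ℝ≥0 using ha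
    lift c to ℝ≥0 using hc'
    norm_cast at h0 hc
    rw [← ENNReal.coe_div h0, ← ENNReal.coe_div hc]
    norm_cast
    have ha : (0 : ℝ) < a := by positivity
    have hc : (0 : ℝ) < c := by positivity
    rw [← NNReal.coe_le_coe]
    push_cast
    rw [div_add_div _ _ hc.ne' ha.ne', le_div_iff₀ (by positivity)]
    nlinarith [sq_nonneg ((a : ℝ) - c)]

/-- The harmonic-arithmetic mean inequality for a probability measure. -/
theorem inv_lintegral_le_lintegral_inv (μ : Measure α) [IsProbabilityMeasure μ] {f : α → ℝ≥0∞}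
    (hf : Measurable f) (hfin : ∀ a, f a ≠ ∞) (h0 : ∫⁻ a, f a ∂μ ≠ 0) (h1 : ∫⁻ a, f a ∂μ ≠ ∞) :
    (∫⁻ a, f a ∂μ)⁻¹ ≤ ∫⁻ a, (f a)⁻¹ ∂μ := by
  set c := ∫⁻ a, f a ∂μ with hc
  -- Integrate f/c + c/f ≥ 2, with c the mean of f.
  have key : (2 : ℝ≥0∞) ≤ 1 + c * ∫⁻ a, (f a)⁻¹ ∂μ := by
    calc (2 : ℝ≥0∞) = ∫⁻ _, 2 ∂μ := by simp
      _ ≤ ∫⁻ a, (f a * c⁻¹ + c * (f a)⁻¹) ∂μ :=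
        lintegral_mono fun a => two_le_div_add_div h0 h1 (hfin a)
      _ = 1 + c * ∫⁻ a, (f a)⁻¹ ∂μ := by
        rw [lintegral_add_left (by fun_prop), lintegral_mul_const _ hf,
          lintegral_const_mul c (f := fun a => (f a)⁻¹) hf.inv, ← hc, ENNReal.mul_inv_cancel h0 h1]
  have key' : 1 ≤ c * ∫⁻ a, (f a)⁻¹ ∂μ := by
    rw [← one_add_one_eq_two] at key
    exact (ENNReal.add_le_add_iff_left ENNReal.one_ne_top).1 key
  exact (ENNReal.inv_le_iff_le_mul (fun _ => h0) (fun h => absurd h h1)).2 key'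

theorem integrable_sq_of_lintegral_le {μ : Measure α} {u : α → ℝ} (hu : AEStronglyMeasurable u μ)
    {C : ℝ≥0} (h : ∫⁻ a, ENNReal.ofReal (u a ^ 2) ∂μ ≤ C) : Integrable (fun a => u a ^ 2) μ := by
  refine ⟨hu.pow 2, ?_⟩
  rw [hasFiniteIntegral_iff_ofReal (ae_of_all _ fun a => sq_nonneg _)]
  exact h.trans_lt ENNReal.coe_lt_top

theorem integral_sq_le_of_lintegral_le {μ : Measure α} {u : α → ℝ}
    (hu : AEStronglyMeasurable u μ)
    {C : ℝ≥0} (h : ∫⁻ a, ENNReal.ofReal (u a ^ 2) ∂μ ≤ C) : ∫ a, u a ^ 2 ∂μ ≤ C := by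
  rw [integral_eq_lintegral_of_nonneg_ae (ae_of_all _ fun a => sq_nonneg _) (hu.pow 2)]
  exact ENNReal.toReal_le_coe_of_le_coe h

theorem integrable_of_integrable_sq {μ : Measure α} [IsFiniteMeasure μ] {u : α → ℝ}
    (hu : AEStronglyMeasurable u μ) (h : Integrable (fun a => u a ^ 2) μ) : Integrable u μ :=
  ((memLp_two_iff_integrable_sq hu).2 h).integrable one_le_two

/-- Almost everywhere convergence of functions with bounded second moments implies convergence
of the integrals. -/
theorem tendsto_integral_of_sq_bounded {μ : Measure α} [IsFiniteMeasure μ] {u : ℕ → α → ℝ}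
    {v : α → ℝ} (hu : ∀ n, AEStronglyMeasurable (u n) μ) (hv : AEStronglyMeasurable v μ)
    {C : ℝ≥0} (hC : ∀ n, ∫⁻ a, ENNReal.ofReal (u n a ^ 2) ∂μ ≤ C)
    (hCv : ∫⁻ a, ENNReal.ofReal (v a ^ 2) ∂μ ≤ C)
    (h : ∀ᵐ a ∂μ, Tendsto (fun n => u n a) atTop (𝓝 (v a))) :
    Tendsto (fun n => ∫ a, u n a ∂μ) atTop (𝓝 (∫ a, v a ∂μ)) := by
  -- Clamping to [-M, M] costs at most s²/M pointwise, hence C/M in the mean, uniformly in n;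
  -- clamped functions are handled by dominated convergence.
  let t : ℝ → ℝ → ℝ := fun M s => max (-M) (min s M)
  have ht : ∀ M : ℝ, 0 < M → ∀ s, |s - t M s| ≤ s ^ 2 / M := by
    intro M hM s
    rw [le_div_iff₀ hM]
    simp only [t]
    rcases le_total s M with h1 | h1
    · rcases le_total (-M) s with h2 | h2
      · rw [min_eq_left h1, max_eq_right h2]; simp; positivity
      · rw [min_eq_left h1, max_eq_left h2, abs_of_nonpos (by linarith)]; nlinarith
    · rw [min_eq_right h1, max_eq_right (by linarith), abs_of_nonneg (by linarith)]; nlinarith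
  have htb : ∀ M : ℝ, 0 < M → ∀ s, |t M s| ≤ M := by
    intro M hM s
    rw [abs_le]
    exact ⟨le_max_left _ _, max_le (by linarith) (min_le_right _ _)⟩
  have htc : ∀ M, Continuous (t M) := fun M => by fun_prop
  have hdiff : ∀ M : ℝ, 0 < M → ∀ z : α → ℝ, AEStronglyMeasurable z μ →
      ∫⁻ a, ENNReal.ofReal (z a ^ 2) ∂μ ≤ C →
      |∫ a, z a ∂μ - ∫ a, t M (z a) ∂μ| ≤ C / M := by
    intro M hM z hz hzC
    have hz2 := integrable_sq_of_lintegral_le hz hzC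
    have hz1 := integrable_of_integrable_sq hz hz2
    have hzt : Integrable (fun a => t M (z a)) μ :=
      Integrable.of_bound ((htc M).comp_aestronglyMeasurable hz) M
        (ae_of_all _ fun a => htb M hM _)
    rw [← integral_sub hz1 hzt]
    refine (abs_integral_le_integral_abs).trans ?_
    calc ∫ a, |z a - t M (z a)| ∂μ ≤ ∫ a, z a ^ 2 / M ∂μ :=
          integral_mono (hz1.sub hzt).abs (hz2.div_const M) fun a => ht M hM _
      _ = (∫ a, z a ^ 2 ∂μ) / M := integral_div _ _
      _ ≤ C / M := by gcongr; exact integral_sq_le_of_lintegral_le hz hzC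
  rw [Metric.tendsto_atTop]
  intro ε hε
  obtain ⟨M, hM, hMC⟩ : ∃ M : ℝ, 0 < M ∧ C / M < ε / 3 := by
    refine ⟨3 * (C + 1) / ε, by positivity, ?_⟩
    rw [div_lt_iff₀ (by positivity)]
    have : ε / 3 * (3 * (C + 1) / ε) = C + 1 := by field_simp
    rw [this]; linarith
  have hlim : Tendsto (fun n => ∫ a, t M (u n a) ∂μ) atTop (𝓝 (∫ a, t M (v a) ∂μ)) := by
    refine tendsto_integral_of_dominated_convergence (fun _ => M)
      (fun n => (htc M).comp_aestronglyMeasurable (hu n)) (integrable_const M)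
      (fun n => ae_of_all _ fun a => htb M hM _) ?_
    filter_upwards [h] with a ha
    exact ((htc M).tendsto _).comp ha
  obtain ⟨N, hN⟩ := Metric.tendsto_atTop.1 hlim (ε / 3) (by positivity)
  refine ⟨N, fun n hn => ?_⟩
  have h1 := hN n hn
  have h2 := hdiff M hM (u n) (hu n) (hC n)
  have h3 := hdiff M hM v hv hCv
  rw [Real.dist_eq] at h1 ⊢
  rw [abs_lt] at h1 ⊢
  rw [abs_le] at h2 h3
  constructor <;> linarith [h1.1, h1.2, h2.1, h2.2, h3.1, h3.2]

end General

/-! ### Ratios of mixture densities and the expected log likelihood ratio. -/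

/-- `Ψ` is a probability measure carried by `X`. -/
structure IsMixing (X : Set S2) (Ψ : Measure S2) : Prop where
  isProbabilityMeasure : IsProbabilityMeasure Ψ
  null : Ψ Xᶜ = 0

/-- A kernel which is continuous in the parameter, positive, and whose ratios have bounded second
moments under `ν`. -/
structure RegularKernel (k : S2 → S2 → ℝ≥0) (X : Set S2) (ν : Measure S2) (B : ℝ≥0) : Prop where
  isClosed : IsClosed X
  measurable : Measurable (Function.uncurry k)
  continuousOn : ∀ y, ContinuousOn (k y) X
  pos : ∀ x ∈ X, ∀ᵐ y ∂ν, 0 < k y x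
  sq_le : ∀ x₁ ∈ X, ∀ x₂ ∈ X, ∫⁻ y, ((k y x₁ : ℝ≥0∞) / (k y x₂ : ℝ≥0∞)) ^ 2 ∂ν ≤ B

/-- The ratio of two mixture densities. -/
noncomputable def ratio (k : S2 → S2 → ℝ≥0) (Φ Ψ : Measure S2) (y : S2) : ℝ :=
  (mixture k Φ y / mixture k Ψ y).toReal

/-- The expected log likelihood ratio of two mixture densities. -/
noncomputable def gain (k : S2 → S2 → ℝ≥0) (ν Φ Ψ : Measure S2) : ℝ :=
  ∫ y, Real.log (ratio k Φ Ψ y) ∂ν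

theorem IsMixing.ae_mem {X : Set S2} {Ψ : Measure S2} (hΨ : IsMixing X Ψ) : ∀ᵐ x ∂Ψ, x ∈ X :=
  hΨ.null

theorem measurable_mixture {k : S2 → S2 → ℝ≥0} (hk : Measurable (Function.uncurry k))
    (Ψ : Measure S2) [SFinite Ψ] : Measurable (mixture k Ψ) :=
  Measurable.lintegral_prod_right' (f := fun p : S2 × S2 => (k p.1 p.2 : ℝ≥0∞)) hk.coe_nnreal_ennreal

theorem measurable_ratio {k : S2 → S2 → ℝ≥0} (hk : Measurable (Function.uncurry k))
    (Φ Ψ : Measure S2) [SFinite Φ] [SFinite Ψ] : Measurable (ratio k Φ Ψ) :=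
  ((measurable_mixture hk Φ).div (measurable_mixture hk Ψ)).ennreal_toReal

theorem ratio_nonneg {k : S2 → S2 → ℝ≥0} {Φ Ψ : Measure S2} (y : S2) : 0 ≤ ratio k Φ Ψ y :=
  ENNReal.toReal_nonneg

namespace RegularKernel

variable {k : S2 → S2 → ℝ≥0} {X : Set S2} {ν : Measure S2} {B : ℝ≥0}

theorem measurable_right (H : RegularKernel k X ν B) (y : S2) : Measurable (k y) :=
  H.measurable.comp measurable_prodMk_left

theorem measurable_left (H : RegularKernel k X ν B) (x : S2) : Measurable (fun y => k y x) :=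
  H.measurable.comp measurable_prodMk_right

theorem exists_bound (H : RegularKernel k X ν B) (y : S2) : ∃ M : ℝ≥0, ∀ x ∈ X, k y x ≤ M := by
  obtain ⟨M, hM⟩ := (H.isClosed.isCompact.image_of_continuousOn (H.continuousOn y)).bddAbove
  exact ⟨M, fun x hx => hM (Set.mem_image_of_mem _ hx)⟩

theorem mixture_ne_top (H : RegularKernel k X ν B) {Ψ : Measure S2} (hΨ : IsMixing X Ψ) (y : S2) :
    mixture k Ψ y ≠ ∞ := by
  have := hΨ.isProbabilityMeasure
  obtain ⟨M, hM⟩ := H.exists_bound y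
  refine ((lintegral_mono_ae (g := fun _ => (M : ℝ≥0∞)) ?_).trans_lt ?_).ne
  · filter_upwards [hΨ.ae_mem] with x hx
    exact_mod_cast hM x hx
  · simp

/-- The null set in the positivity of the kernel depends on the parameter; Fubini makes it one null
set of y, off which k(y ∣ ·) is positive Ψ-almost everywhere. -/
theorem ae_mixture_pos [SFinite ν] (H : RegularKernel k X ν B) {Ψ : Measure S2}
    (hΨ : IsMixing X Ψ) : ∀ᵐ y ∂ν, 0 < mixture k Ψ y := by
  have := hΨ.isProbabilityMeasure
  have h1 : ∀ᵐ x ∂Ψ, ∀ᵐ y ∂ν, 0 < k y x := by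
    filter_upwards [hΨ.ae_mem] with x hx using H.pos x hx
  have h2 : ∀ᵐ y ∂ν, ∀ᵐ x ∂Ψ, 0 < k y x := by
    refine (Measure.ae_ae_comm ?_).1 h1
    exact measurableSet_lt measurable_const (H.measurable.comp measurable_swap)
  filter_upwards [h2] with y hy
  refine pos_iff_ne_zero.2 fun h => ?_
  rw [mixture, lintegral_eq_zero_iff (H.measurable_right y).coe_nnreal_ennreal] at h
  have h3 : ∀ᵐ x ∂Ψ, False := by
    filter_upwards [hy, h] with x a b
    simp only [Pi.zero_apply, ENNReal.coe_eq_zero] at b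
    exact a.ne' b
  obtain ⟨x, hx⟩ := h3.exists
  exact hx

/-- The harmonic-arithmetic inequality bounds 1/f_Ψ by the Ψ-mean of 1/k. This removes the integral
from the denominator, so that the assumption on kernel ratios can be applied under the integral
sign. -/
theorem mixture_div_le [SFinite ν] (H : RegularKernel k X ν B) {Φ Ψ : Measure S2}
    (hΨ : IsMixing X Ψ) {y : S2} (hy : 0 < mixture k Ψ y) :
    mixture k Φ y / mixture k Ψ y ≤ ∫⁻ x₁, ∫⁻ x₂, (k y x₁ : ℝ≥0∞) / k y x₂ ∂Ψ ∂Φ := by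
  have := hΨ.isProbabilityMeasure
  have hk := (H.measurable_right y).coe_nnreal_ennreal
  have h := inv_lintegral_le_lintegral_inv Ψ hk (by simp) hy.ne' (H.mixture_ne_top hΨ y)
  calc mixture k Φ y / mixture k Ψ y
      ≤ mixture k Φ y * ∫⁻ x, (k y x : ℝ≥0∞)⁻¹ ∂Ψ := by rw [div_eq_mul_inv]; gcongr; exact h
    _ = ∫⁻ x₁, ∫⁻ x₂, (k y x₁ : ℝ≥0∞) / k y x₂ ∂Ψ ∂Φ := by
      simp only [div_eq_mul_inv]
      rw [mixture, ← lintegral_mul_const _ hk]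
      congr with x₁
      rw [lintegral_const_mul _ (f := fun x => (k y x : ℝ≥0∞)⁻¹) hk.inv]

/-- The second moment of a ratio of mixture densities is at most that of the kernel ratios. -/
theorem lintegral_mixture_div_sq_le [SFinite ν] (H : RegularKernel k X ν B) {Φ Ψ : Measure S2}
    (hΦ : IsMixing X Φ) (hΨ : IsMixing X Ψ) :
    ∫⁻ y, (mixture k Φ y / mixture k Ψ y) ^ 2 ∂ν ≤ B := by
  have := hΨ.isProbabilityMeasure
  have := hΦ.isProbabilityMeasure
  have hm : Measurable (fun q : S2 × (S2 × S2) => ((k q.1 q.2.1 : ℝ≥0∞) / k q.1 q.2.2) ^ 2) := by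
    have h1 : Measurable fun q : S2 × (S2 × S2) => k q.1 q.2.1 :=
      H.measurable.comp (f := fun q : S2 × (S2 × S2) => (q.1, q.2.1)) (by fun_prop)
    have h2 : Measurable fun q : S2 × (S2 × S2) => k q.1 q.2.2 :=
      H.measurable.comp (f := fun q : S2 × (S2 × S2) => (q.1, q.2.2)) (by fun_prop)
    exact (h1.coe_nnreal_ennreal.div h2.coe_nnreal_ennreal).pow_const 2
  have hm1 : ∀ y, Measurable (fun q : S2 × S2 => (k y q.1 : ℝ≥0∞) / k y q.2) := fun y =>
    ((H.measurable_right y).comp measurable_fst).coe_nnreal_ennreal.div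
      ((H.measurable_right y).comp measurable_snd).coe_nnreal_ennreal
  calc ∫⁻ y, (mixture k Φ y / mixture k Ψ y) ^ 2 ∂ν
      ≤ ∫⁻ y, ∫⁻ q, ((k y q.1 : ℝ≥0∞) / k y q.2) ^ 2 ∂(Φ.prod Ψ) ∂ν := by
        refine lintegral_mono_ae ?_
        filter_upwards [H.ae_mixture_pos hΨ] with y hy
        refine le_trans ?_ (sq_lintegral_le_lintegral_sq _ (hm1 y).aemeasurable)
        gcongr
        rw [lintegral_prod _ (hm1 y).aemeasurable]
        exact H.mixture_div_le hΨ hy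
    _ = ∫⁻ q, ∫⁻ y, ((k y q.1 : ℝ≥0∞) / k y q.2) ^ 2 ∂ν ∂(Φ.prod Ψ) :=
        lintegral_lintegral_swap hm.aemeasurable
    _ ≤ ∫⁻ _, B ∂(Φ.prod Ψ) := by
        refine lintegral_mono_ae ?_
        filter_upwards [Measure.quasiMeasurePreserving_fst.ae hΦ.ae_mem,
          Measure.quasiMeasurePreserving_snd.ae hΨ.ae_mem] with q h1 h2
        exact H.sq_le _ h1 _ h2
    _ = B := by simp

theorem ofReal_ratio [SFinite ν] (H : RegularKernel k X ν B) {Φ Ψ : Measure S2}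
    (hΦ : IsMixing X Φ) {y : S2} (hy : 0 < mixture k Ψ y) :
    ENNReal.ofReal (ratio k Φ Ψ y) = mixture k Φ y / mixture k Ψ y :=
  ENNReal.ofReal_toReal (ENNReal.div_ne_top (H.mixture_ne_top hΦ y) hy.ne')

theorem ratio_pos (H : RegularKernel k X ν B) {Φ Ψ : Measure S2}
    (hΦ : IsMixing X Φ) (hΨ : IsMixing X Ψ) {y : S2} (h1 : 0 < mixture k Φ y)
    (h2 : 0 < mixture k Ψ y) : 0 < ratio k Φ Ψ y :=
  ENNReal.toReal_pos (ENNReal.div_pos h1.ne' (H.mixture_ne_top hΨ y)).ne'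
    (ENNReal.div_ne_top (H.mixture_ne_top hΦ y) h2.ne')

theorem ae_ratio_pos [SFinite ν] (H : RegularKernel k X ν B) {Φ Ψ : Measure S2}
    (hΦ : IsMixing X Φ) (hΨ : IsMixing X Ψ) : ∀ᵐ y ∂ν, 0 < ratio k Φ Ψ y := by
  filter_upwards [H.ae_mixture_pos hΦ, H.ae_mixture_pos hΨ] with y h1 h2
  exact H.ratio_pos hΦ hΨ h1 h2

theorem lintegral_ratio_sq_le [SFinite ν] (H : RegularKernel k X ν B) {Φ Ψ : Measure S2}
    (hΦ : IsMixing X Φ) (hΨ : IsMixing X Ψ) :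
    ∫⁻ y, ENNReal.ofReal (ratio k Φ Ψ y ^ 2) ∂ν ≤ B := by
  refine le_trans (lintegral_mono_ae ?_) (H.lintegral_mixture_div_sq_le hΦ hΨ)
  filter_upwards [H.ae_mixture_pos hΨ] with y hy
  rw [ENNReal.ofReal_pow (ratio_nonneg y), H.ofReal_ratio hΦ hy]

theorem aestronglyMeasurable_ratio (H : RegularKernel k X ν B) {Φ Ψ : Measure S2}
    (hΦ : IsMixing X Φ) (hΨ : IsMixing X Ψ) : AEStronglyMeasurable (ratio k Φ Ψ) ν := by
  have := hΨ.isProbabilityMeasure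
  have := hΦ.isProbabilityMeasure
  exact (measurable_ratio H.measurable Φ Ψ).aestronglyMeasurable

theorem aestronglyMeasurable_log_ratio (H : RegularKernel k X ν B) {Φ Ψ : Measure S2}
    (hΦ : IsMixing X Φ) (hΨ : IsMixing X Ψ) :
    AEStronglyMeasurable (fun y => Real.log (ratio k Φ Ψ y)) ν := by
  have := hΨ.isProbabilityMeasure
  have := hΦ.isProbabilityMeasure
  exact (measurable_ratio H.measurable Φ Ψ).log.aestronglyMeasurable

theorem integrable_ratio_sq [SFinite ν] (H : RegularKernel k X ν B) {Φ Ψ : Measure S2}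
    (hΦ : IsMixing X Φ) (hΨ : IsMixing X Ψ) : Integrable (fun y => ratio k Φ Ψ y ^ 2) ν :=
  integrable_sq_of_lintegral_le (H.aestronglyMeasurable_ratio hΦ hΨ)
    (H.lintegral_ratio_sq_le hΦ hΨ)

theorem integral_ratio_sq_le [SFinite ν] (H : RegularKernel k X ν B) {Φ Ψ : Measure S2}
    (hΦ : IsMixing X Φ) (hΨ : IsMixing X Ψ) : ∫ y, ratio k Φ Ψ y ^ 2 ∂ν ≤ B :=
  integral_sq_le_of_lintegral_le (H.aestronglyMeasurable_ratio hΦ hΨ)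
    (H.lintegral_ratio_sq_le hΦ hΨ)

theorem integrable_ratio [IsFiniteMeasure ν] (H : RegularKernel k X ν B) {Φ Ψ : Measure S2}
    (hΦ : IsMixing X Φ) (hΨ : IsMixing X Ψ) : Integrable (ratio k Φ Ψ) ν :=
  integrable_of_integrable_sq (H.aestronglyMeasurable_ratio hΦ hΨ) (H.integrable_ratio_sq hΦ hΨ)

end RegularKernel

theorem ratio_inv (k : S2 → S2 → ℝ≥0) (Φ Ψ : Measure S2) (y : S2) :
    (ratio k Φ Ψ y)⁻¹ = ratio k Ψ Φ y := by
  rw [ratio, ratio, ENNReal.toReal_div, ENNReal.toReal_div, inv_div]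

/-- One of the two squares suffices on each side of 1. Both are needed and both are available, since
the inverse of a ratio of mixtures is again such a ratio. -/
theorem sq_log_le {r : ℝ} (hr : 0 < r) : Real.log r ^ 2 ≤ r ^ 2 + r⁻¹ ^ 2 := by
  rcases le_total 1 r with h | h
  · have h1 := Real.log_nonneg h
    have h2 := Real.log_le_sub_one_of_pos hr
    nlinarith [sq_nonneg r⁻¹]
  · have hi : 0 < r⁻¹ := inv_pos.2 hr
    have h1 := Real.log_nonpos hr.le h
    have h2 := Real.log_le_sub_one_of_pos hi
    rw [Real.log_inv] at h2
    nlinarith [sq_nonneg r]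

namespace RegularKernel

variable {k : S2 → S2 → ℝ≥0} {X : Set S2} {ν : Measure S2} {B : ℝ≥0}

theorem lintegral_log_ratio_sq_le [SFinite ν] (H : RegularKernel k X ν B) {Φ Ψ : Measure S2}
    (hΦ : IsMixing X Φ) (hΨ : IsMixing X Ψ) :
    ∫⁻ y, ENNReal.ofReal (Real.log (ratio k Φ Ψ y) ^ 2) ∂ν ≤ (B + B : ℝ≥0) := by
  have := hΨ.isProbabilityMeasure
  have := hΦ.isProbabilityMeasure
  calc ∫⁻ y, ENNReal.ofReal (Real.log (ratio k Φ Ψ y) ^ 2) ∂ν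
      ≤ ∫⁻ y, (ENNReal.ofReal (ratio k Φ Ψ y ^ 2) + ENNReal.ofReal (ratio k Ψ Φ y ^ 2)) ∂ν := by
        refine lintegral_mono_ae ?_
        filter_upwards [H.ae_ratio_pos hΦ hΨ] with y hy
        rw [← ENNReal.ofReal_add (sq_nonneg _) (sq_nonneg _), ← ratio_inv k Φ Ψ]
        exact ENNReal.ofReal_le_ofReal (sq_log_le hy)
    _ = _ := lintegral_add_left
        ((measurable_ratio H.measurable Φ Ψ).pow_const 2).ennreal_ofReal _
    _ ≤ _ := by
        push_cast
        exact add_le_add (H.lintegral_ratio_sq_le hΦ hΨ) (H.lintegral_ratio_sq_le hΨ hΦ)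

theorem integrable_log_ratio [IsFiniteMeasure ν] (H : RegularKernel k X ν B) {Φ Ψ : Measure S2}
    (hΦ : IsMixing X Φ) (hΨ : IsMixing X Ψ) :
    Integrable (fun y => Real.log (ratio k Φ Ψ y)) ν :=
  integrable_of_integrable_sq (H.aestronglyMeasurable_log_ratio hΦ hΨ)
    (integrable_sq_of_lintegral_le (H.aestronglyMeasurable_log_ratio hΦ hΨ)
      (H.lintegral_log_ratio_sq_le hΦ hΨ))

theorem abs_gain_le [IsProbabilityMeasure ν] (H : RegularKernel k X ν B) {Φ Ψ : Measure S2}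
    (hΦ : IsMixing X Φ) (hΨ : IsMixing X Ψ) : |gain k ν Φ Ψ| ≤ 2 * B + 1 := by
  have h2 := integrable_sq_of_lintegral_le (H.aestronglyMeasurable_log_ratio hΦ hΨ)
      (H.lintegral_log_ratio_sq_le hΦ hΨ)
  have h3 := integral_sq_le_of_lintegral_le (H.aestronglyMeasurable_log_ratio hΦ hΨ)
      (H.lintegral_log_ratio_sq_le hΦ hΨ)
  calc |gain k ν Φ Ψ| ≤ ∫ y, |Real.log (ratio k Φ Ψ y)| ∂ν := abs_integral_le_integral_abs
    _ ≤ ∫ y, (Real.log (ratio k Φ Ψ y) ^ 2 + 1) ∂ν := by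
      refine integral_mono (H.integrable_log_ratio hΦ hΨ).abs (h2.add (integrable_const 1))
        fun y => ?_
      dsimp only
      rw [← sq_abs]
      nlinarith [sq_nonneg (|Real.log (ratio k Φ Ψ y)| - 1), abs_nonneg (Real.log (ratio k Φ Ψ y))]
    _ = ∫ y, Real.log (ratio k Φ Ψ y) ^ 2 ∂ν + 1 := by
      rw [integral_add h2 (integrable_const 1)]; simp
    _ ≤ 2 * B + 1 := by push_cast at h3; linarith

/-- The chain rule by which gains of successive estimates telescope; integrability of each log ratio
is what permits the splitting. -/
theorem gain_add_gain [IsFiniteMeasure ν] (H : RegularKernel k X ν B) {Φ Ψ Ξ : Measure S2}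
    (hΦ : IsMixing X Φ) (hΨ : IsMixing X Ψ) (hΞ : IsMixing X Ξ) :
    gain k ν Φ Ψ + gain k ν Ψ Ξ = gain k ν Φ Ξ := by
  rw [gain, gain, gain, ← integral_add (H.integrable_log_ratio hΦ hΨ)
    (H.integrable_log_ratio hΨ hΞ)]
  refine integral_congr_ae ?_
  filter_upwards [H.ae_ratio_pos hΦ hΨ, H.ae_ratio_pos hΨ hΞ, H.ae_mixture_pos hΨ] with y h1 h2 h3
  rw [← Real.log_mul h1.ne' h2.ne']
  congr 1
  rw [ratio, ratio, ratio, ENNReal.toReal_div, ENNReal.toReal_div, ENNReal.toReal_div]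
  have : (mixture k Ψ y).toReal ≠ 0 :=
    (ENNReal.toReal_pos h3.ne' (H.mixture_ne_top hΨ y)).ne'
  field_simp

theorem gain_le_integral_ratio_sub_one [IsFiniteMeasure ν] (H : RegularKernel k X ν B)
    {Φ Ψ : Measure S2} (hΦ : IsMixing X Φ) (hΨ : IsMixing X Ψ) :
    gain k ν Φ Ψ ≤ ∫ y, (ratio k Φ Ψ y - 1) ∂ν := by
  refine integral_mono_ae (H.integrable_log_ratio hΦ hΨ)
    ((H.integrable_ratio hΦ hΨ).sub (integrable_const 1)) ?_
  filter_upwards [H.ae_ratio_pos hΦ hΨ] with y hy using Real.log_le_sub_one_of_pos hy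

/-- The expected log likelihood ratio depends continuously on the mixture density. -/
theorem tendsto_gain [IsFiniteMeasure ν] (H : RegularKernel k X ν B) {P : ℕ → Measure S2}
    {Φ Ψ : Measure S2} (hP : ∀ n, IsMixing X (P n)) (hΦ : IsMixing X Φ) (hΨ : IsMixing X Ψ)
    (h : ∀ y, Tendsto (fun n => mixture k (P n) y) atTop (𝓝 (mixture k Φ y))) :
    Tendsto (fun n => gain k ν (P n) Ψ) atTop (𝓝 (gain k ν Φ Ψ)) := by
  refine tendsto_integral_of_sq_bounded (fun n => H.aestronglyMeasurable_log_ratio (hP n) hΨ)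
    (H.aestronglyMeasurable_log_ratio hΦ hΨ) (fun n => H.lintegral_log_ratio_sq_le (hP n) hΨ)
    (H.lintegral_log_ratio_sq_le hΦ hΨ) ?_
  -- The second moment bound does not depend on n, so pointwise convergence is enough; log is
  -- continuous at the limit ratio, which is positive almost everywhere.
  filter_upwards [H.ae_mixture_pos hΨ, H.ae_ratio_pos hΦ hΨ] with y h1 h2
  refine ((Real.continuousAt_log h2.ne').tendsto).comp ?_
  refine (ENNReal.tendsto_toReal ?_).comp ?_
  · exact ENNReal.div_ne_top (H.mixture_ne_top hΦ y) h1.ne'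
  · exact ENNReal.Tendsto.div_const (h y) (Or.inr h1.ne')

end RegularKernel

/-! ### Martingales driven by an iid sequence. -/

section Martingale

variable {E : Type*} [MeasurableSpace E]

/-- The sequence with the entries from the `n`-th on replaced by `s₀`. -/
def truncSeq (s₀ : E) (n : ℕ) (p : ℕ → E) : ℕ → E := fun i => if i < n then p i else s₀

theorem measurable_truncSeq (s₀ : E) (n : ℕ) : Measurable (truncSeq s₀ n) := by
  refine measurable_pi_iff.2 fun i => ?_
  by_cases h : i < n
  · simp only [truncSeq, h, if_true]; exact measurable_pi_apply i
  · simp only [truncSeq, h, if_false]; exact measurable_const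

theorem truncSeq_truncSeq {E : Type*} (s₀ : E) {m n : ℕ} (h : m ≤ n) (p : ℕ → E) :
    truncSeq s₀ m (truncSeq s₀ n p) = truncSeq s₀ m p := by
  funext i
  by_cases hi : i < m
  · simp [truncSeq, hi, hi.trans_le h]
  · simp [truncSeq, hi]

variable {Ω : Type*} [MeasurableSpace Ω] {Pr : Measure Ω} [IsProbabilityMeasure Pr]
  {ν : Measure E} {Y : ℕ → Ω → E}

/-- The first `n` observations, followed by the constant `s₀`. -/
def past (s₀ : E) (Y : ℕ → Ω → E) (n : ℕ) (ω : Ω) : ℕ → E := truncSeq s₀ n fun i => Y i ω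

theorem measurable_past (s₀ : E) (hY : ∀ i, Measurable (Y i)) (n : ℕ) :
    Measurable (past s₀ Y n) :=
  (measurable_truncSeq s₀ n).comp (measurable_pi_iff.2 hY)

theorem indepFun_past {Pr : Measure Ω} (s₀ : E) (hY : ∀ i, Measurable (Y i)) (hind : iIndepFun Y Pr) (n : ℕ) :
    IndepFun (past s₀ Y n) (Y n) Pr := by
  have h := hind.indepFun_finset (Finset.range n) {n} (by simp) hY
  -- The padded sequence is a measurable function of the finite tuple before index n.
  let φ : ((i : Finset.range n) → E) → ℕ → E := fun g i =>
    if h : i < n then g ⟨i, Finset.mem_range.2 h⟩ else s₀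
  have hφ : Measurable φ := by
    refine measurable_pi_iff.2 fun i => ?_
    by_cases h : i < n
    · simp only [φ, h, dif_pos]; exact measurable_pi_apply _
    · simp only [φ, h, dif_neg, not_false_eq_true]; exact measurable_const
  have hψ : Measurable (fun g : ({n} : Finset ℕ) → E => g ⟨n, by simp⟩) := measurable_pi_apply _
  have h' := h.comp hφ hψ
  convert h' using 1
  · funext ω i
    by_cases h : i < n <;> simp [φ, h, past, truncSeq]
  · rfl

theorem map_past_prod (s₀ : E) (hY : ∀ i, Measurable (Y i)) (hind : iIndepFun Y Pr)
    (hlaw : ∀ i, Pr.map (Y i) = ν) (n : ℕ) :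
    Pr.map (fun ω => (past s₀ Y n ω, Y n ω)) = (Pr.map (past s₀ Y n)).prod ν := by
  rw [(indepFun_iff_map_prod_eq_prod_map_map (measurable_past s₀ hY n).aemeasurable
    (hY n).aemeasurable).1 (indepFun_past s₀ hY hind n), hlaw]

variable [IsProbabilityMeasure ν]

/-- By independence the past and the next observation have a product law, so conditioning on the
past is integration of the last argument against ν. -/
theorem lintegral_past (s₀ : E) (hY : ∀ i, Measurable (Y i)) (hind : iIndepFun Y Pr)
    (hlaw : ∀ i, Pr.map (Y i) = ν) (n : ℕ) {F : (ℕ → E) → E → ℝ≥0∞}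
    (hF : Measurable (Function.uncurry F)) :
    ∫⁻ ω, F (past s₀ Y n ω) (Y n ω) ∂Pr = ∫⁻ ω, ∫⁻ y, F (past s₀ Y n ω) y ∂ν ∂Pr := by
  have hp := measurable_past s₀ hY n
  have h := lintegral_map (μ := Pr) hF (hp.prodMk (hY n))
  rw [map_past_prod s₀ hY hind hlaw, lintegral_prod _ hF.aemeasurable,
    lintegral_map hF.lintegral_prod_right' hp] at h
  exact h.symm

/-- The deviation of a function of the past and the next observation from its mean given the
past. -/
noncomputable def innov (ν : Measure E) (G : (ℕ → E) → E → ℝ) (p : ℕ → E) (y : E) : ℝ :=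
  G p y - ∫ z, G p z ∂ν

theorem measurable_innov {G : (ℕ → E) → E → ℝ} (hG : Measurable (Function.uncurry G)) :
    Measurable (Function.uncurry (innov ν G)) := by
  have h : StronglyMeasurable (fun p : ℕ → E => ∫ z, G p z ∂ν) :=
    hG.stronglyMeasurable.integral_prod_right
  exact hG.sub (h.measurable.comp measurable_fst)

theorem lintegral_innov_sq_le {G : (ℕ → E) → E → ℝ} (hG : Measurable (Function.uncurry G))
    {C : ℝ≥0} {p : ℕ → E} (h : ∫⁻ y, ENNReal.ofReal (G p y ^ 2) ∂ν ≤ C) :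
    ∫⁻ y, ENNReal.ofReal (innov ν G p y ^ 2) ∂ν ≤ C := by
  have hm : Measurable (G p) := hG.comp measurable_prodMk_left
  have h2 := integrable_sq_of_lintegral_le hm.aestronglyMeasurable h
  have hL : MemLp (G p) 2 ν := (memLp_two_iff_integrable_sq hm.aestronglyMeasurable).2 h2
  have hv := variance_le_expectation_sq (μ := ν) (X := G p) hm.aestronglyMeasurable
  rw [variance_eq_integral hm.aemeasurable] at hv
  have hi : Integrable (fun y => innov ν G p y ^ 2) ν :=
    (hL.sub (memLp_const (∫ z, G p z ∂ν))).integrable_sq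
  rw [← ofReal_integral_eq_lintegral_ofReal hi (ae_of_all _ fun y => sq_nonneg _)]
  refine (ENNReal.ofReal_le_ofReal (hv.trans
    (integral_sq_le_of_lintegral_le hm.aestronglyMeasurable h))).trans ?_
  simp

theorem integral_innov_eq_zero {G : (ℕ → E) → E → ℝ} (hG : Measurable (Function.uncurry G))
    {C : ℝ≥0} {p : ℕ → E} (h : ∫⁻ y, ENNReal.ofReal (G p y ^ 2) ∂ν ≤ C) :
    ∫ y, innov ν G p y ∂ν = 0 := by
  have hm : Measurable (G p) := hG.comp measurable_prodMk_left
  have h2 := integrable_sq_of_lintegral_le hm.aestronglyMeasurable h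
  have h1 := integrable_of_integrable_sq hm.aestronglyMeasurable h2
  simp only [innov]
  rw [integral_sub h1 (integrable_const _)]
  simp

variable {G : ℕ → (ℕ → E) → E → ℝ} {C : ℝ≥0}

theorem memLp_innov (s₀ : E) (hY : ∀ i, Measurable (Y i)) (hind : iIndepFun Y Pr)
    (hlaw : ∀ i, Pr.map (Y i) = ν) (hG : ∀ n, Measurable (Function.uncurry (G n)))
    (hC : ∀ n, ∀ᵐ ω ∂Pr, ∫⁻ y, ENNReal.ofReal (G n (past s₀ Y n ω) y ^ 2) ∂ν ≤ C) (n : ℕ) :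
    MemLp (fun ω => innov ν (G n) (past s₀ Y n ω) (Y n ω)) 2 Pr ∧
      ∫ ω, innov ν (G n) (past s₀ Y n ω) (Y n ω) ^ 2 ∂Pr ≤ C := by
  have hm : AEStronglyMeasurable (fun ω => innov ν (G n) (past s₀ Y n ω) (Y n ω)) Pr :=
    ((measurable_innov (hG n)).comp
      ((measurable_past s₀ hY n).prodMk (hY n))).aestronglyMeasurable
  have hb : ∫⁻ ω, ENNReal.ofReal (innov ν (G n) (past s₀ Y n ω) (Y n ω) ^ 2) ∂Pr ≤ C := by
    rw [lintegral_past s₀ hY hind hlaw n (F := fun p y => ENNReal.ofReal (innov ν (G n) p y ^ 2))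
      ((measurable_innov (hG n)).pow_const 2).ennreal_ofReal]
    calc _ ≤ ∫⁻ _, C ∂Pr := by
          refine lintegral_mono_ae ?_
          filter_upwards [hC n] with ω hω using lintegral_innov_sq_le (hG n) hω
      _ = C := by simp
  exact ⟨(memLp_two_iff_integrable_sq hm).2 (integrable_sq_of_lintegral_le hm hb),
    integral_sq_le_of_lintegral_le hm hb⟩

/-- Innovations are orthogonal to functions of the past. -/
theorem integral_mul_innov (s₀ : E) (hY : ∀ i, Measurable (Y i)) (hind : iIndepFun Y Pr)
    (hlaw : ∀ i, Pr.map (Y i) = ν) (hG : ∀ n, Measurable (Function.uncurry (G n)))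
    (hC : ∀ n, ∀ᵐ ω ∂Pr, ∫⁻ y, ENNReal.ofReal (G n (past s₀ Y n ω) y ^ 2) ∂ν ≤ C) (n : ℕ)
    {h : (ℕ → E) → ℝ} (hh : Measurable h) (hL : MemLp (fun ω => h (past s₀ Y n ω)) 2 Pr) :
    ∫ ω, h (past s₀ Y n ω) * innov ν (G n) (past s₀ Y n ω) (Y n ω) ∂Pr = 0 := by
  have hp := measurable_past s₀ hY n
  have hint := hL.integrable_mul (memLp_innov s₀ hY hind hlaw hG hC n).1
  have hu : Measurable (fun q : (ℕ → E) × E => h q.1 * innov ν (G n) q.1 q.2) :=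
    (hh.comp measurable_fst).mul (measurable_innov (hG n))
  have hpair : Measurable (fun ω => (past s₀ Y n ω, Y n ω)) := hp.prodMk (hY n)
  have e := integral_map (μ := Pr) hpair.aemeasurable
    (f := fun q : (ℕ → E) × E => h q.1 * innov ν (G n) q.1 q.2) hu.aestronglyMeasurable
  rw [← e, map_past_prod s₀ hY hind hlaw]
  have hi : Integrable (fun q : (ℕ → E) × E => h q.1 * innov ν (G n) q.1 q.2)
      ((Pr.map (past s₀ Y n)).prod ν) := by
    rw [← map_past_prod s₀ hY hind hlaw, integrable_map_measure hu.aestronglyMeasurable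
      hpair.aemeasurable]
    exact hint
  have : IsProbabilityMeasure (Pr.map (past s₀ Y n)) :=
    Measure.isProbabilityMeasure_map hp.aemeasurable
  rw [integral_prod _ hi]
  refine integral_eq_zero_of_ae ?_
  -- The moment bound holds only for almost every past; measurability of this set transfers it to
  -- the law of the past.
  have hms : MeasurableSet {p : ℕ → E | ∫⁻ y, ENNReal.ofReal (G n p y ^ 2) ∂ν ≤ C} :=
    measurableSet_le (((hG n).pow_const 2).ennreal_ofReal.lintegral_prod_right') measurable_const
  filter_upwards [(ae_map_iff hp.aemeasurable hms).2 (hC n)] with p hpC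
  rw [integral_const_mul, integral_innov_eq_zero (hG n) hpC]
  simp

/-- The weighted sum of the first `n` innovations. -/
noncomputable def innovSum (s₀ : E) (ν : Measure E) (w : ℕ → ℝ) (G : ℕ → (ℕ → E) → E → ℝ) (n : ℕ)
    (p : ℕ → E) : ℝ :=
  ∑ i ∈ Finset.range n, w i * innov ν (G i) (truncSeq s₀ i p) (p i)

theorem measurable_innovSum (s₀ : E) (w : ℕ → ℝ) (hG : ∀ n, Measurable (Function.uncurry (G n)))
    (n : ℕ) : Measurable (innovSum s₀ ν w G n) := by
  refine Finset.measurable_fun_sum _ fun i _ => ?_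
  exact ((measurable_innov (hG i)).comp
    ((measurable_truncSeq s₀ i).prodMk (measurable_pi_apply i))).const_mul _

/-- Innovation i involves only observations up to index i, so truncating at n > i changes nothing.
This exhibits the sum as a function of the past, which gives adaptedness. -/
theorem innovSum_past {E Ω : Type*} [MeasurableSpace E] {ν : Measure E} {Y : ℕ → Ω → E}
    {G : ℕ → (ℕ → E) → E → ℝ} (s₀ : E) (w : ℕ → ℝ) {m n : ℕ} (hmn : m ≤ n) (ω : Ω) :
    innovSum s₀ ν w G m (past s₀ Y n ω) =
      ∑ i ∈ Finset.range m, w i * innov ν (G i) (past s₀ Y i ω) (Y i ω) := by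
  refine Finset.sum_congr rfl fun i hi => ?_
  have hi' : i < n := (Finset.mem_range.1 hi).trans_le hmn
  rw [past, truncSeq_truncSeq s₀ hi'.le]
  simp [truncSeq, hi', past]

/-- The filtration generated by the observations; the first `n` of them are known at time `n`. -/
def pastFiltration (s₀ : E) (hY : ∀ i, Measurable (Y i)) :
    Filtration ℕ (inferInstance : MeasurableSpace Ω) where
  seq n := MeasurableSpace.comap (past s₀ Y n) MeasurableSpace.pi
  mono' m n hmn := by
    have h : past s₀ Y m = truncSeq s₀ m ∘ past s₀ Y n := by
      funext ω
      exact (truncSeq_truncSeq s₀ hmn _).symm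
    change MeasurableSpace.comap (past s₀ Y m) _ ≤ MeasurableSpace.comap (past s₀ Y n) _
    rw [h, ← MeasurableSpace.comap_comp]
    exact MeasurableSpace.comap_mono (measurable_truncSeq s₀ m).comap_le
  le' n := (measurable_past s₀ hY n).comap_le

/-- Square summable weighted sums of innovations converge. -/
theorem ae_exists_tendsto_sum_innov (s₀ : E) (hY : ∀ i, Measurable (Y i)) (hind : iIndepFun Y Pr)
    (hlaw : ∀ i, Pr.map (Y i) = ν) (hG : ∀ n, Measurable (Function.uncurry (G n)))
    (hC : ∀ n, ∀ᵐ ω ∂Pr, ∫⁻ y, ENNReal.ofReal (G n (past s₀ Y n ω) y ^ 2) ∂ν ≤ C)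
    {w : ℕ → ℝ} (hw : Summable (fun i => w i ^ 2)) :
    ∀ᵐ ω ∂Pr, ∃ l, Tendsto (fun n => ∑ i ∈ Finset.range n,
      w i * innov ν (G i) (past s₀ Y i ω) (Y i ω)) atTop (𝓝 l) := by
  set Δ : ℕ → Ω → ℝ := fun n ω => innov ν (G n) (past s₀ Y n ω) (Y n ω) with hΔ
  set M : ℕ → Ω → ℝ := fun n ω => ∑ i ∈ Finset.range n, w i * Δ i ω with hM
  have hMeq : ∀ n, M n = fun ω => innovSum s₀ ν w G n (past s₀ Y n ω) := fun n => by
    funext ω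
    exact (innovSum_past s₀ w le_rfl ω).symm
  have hΔL : ∀ n, MemLp (Δ n) 2 Pr := fun n => (memLp_innov s₀ hY hind hlaw hG hC n).1
  have hML : ∀ n, MemLp (M n) 2 Pr := fun n =>
    memLp_finsetSum (Finset.range n) fun i _ => (hΔL i).const_mul (w i)
  have hsucc : ∀ n, M (n + 1) = fun ω => M n ω + w n * Δ n ω := fun n => by
    funext ω
    simp only [hM, Finset.sum_range_succ]
  have horth : ∀ n, ∫ ω, M n ω * Δ n ω ∂Pr = 0 := fun n => by
    have := integral_mul_innov s₀ hY hind hlaw hG hC n (measurable_innovSum s₀ w hG n)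
      (by rw [← hMeq n]; exact hML n)
    rw [hMeq n]
    exact this
  -- Orthogonality kills the cross term when the square is expanded.
  have hvar : ∀ n, ∫ ω, M n ω ^ 2 ∂Pr ≤ C * ∑ i ∈ Finset.range n, w i ^ 2 := by
    intro n
    induction n with
    | zero => simp [hM]
    | succ n ih =>
      have e : ∫ ω, M (n + 1) ω ^ 2 ∂Pr = ∫ ω, M n ω ^ 2 ∂Pr + 2 * w n * ∫ ω, M n ω * Δ n ω ∂Pr
          + w n ^ 2 * ∫ ω, Δ n ω ^ 2 ∂Pr := by
        have i1 := (hML n).integrable_sq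
        have i2 : Integrable (fun ω => M n ω * Δ n ω) Pr := (hML n).integrable_mul (hΔL n)
        have i3 := (hΔL n).integrable_sq
        have i4 : Integrable (fun ω => M n ω ^ 2 + 2 * w n * (M n ω * Δ n ω)) Pr :=
          i1.add (i2.const_mul _)
        rw [← integral_const_mul, ← integral_const_mul, ← integral_add i1 (i2.const_mul _),
          ← integral_add i4 (i3.const_mul _)]
        congr with ω
        rw [hsucc]
        ring
      rw [e, horth, Finset.sum_range_succ]
      have := (memLp_innov s₀ hY hind hlaw hG hC n).2
      have := mul_le_mul_of_nonneg_left this (sq_nonneg (w n))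
      nlinarith
  have hmart : Martingale M (pastFiltration s₀ hY) Pr := by
    refine martingale_nat ?_ (fun n => (hML n).integrable one_le_two) ?_
    · intro n
      rw [hMeq]
      exact ((measurable_innovSum s₀ w hG n).comp (comap_measurable _)).stronglyMeasurable
    · intro n
      refine ae_eq_condExp_of_forall_setIntegral_eq ((pastFiltration s₀ hY).le n)
        ((hML _).integrable one_le_two) (fun _ _ _ => ((hML _).integrable one_le_two).integrableOn)
        ?_ ?_
      · rintro s ⟨T, hT, rfl⟩ -
        have hs : MeasurableSet (past s₀ Y n ⁻¹' T) := measurable_past s₀ hY n hT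
        -- The martingale property is orthogonality of the innovation to indicators of past events.
        have h0 : ∫ ω in past s₀ Y n ⁻¹' T, Δ n ω ∂Pr = 0 := by
          have := integral_mul_innov s₀ hY hind hlaw hG hC n
            (h := T.indicator fun _ => (1 : ℝ)) (measurable_const.indicator hT)
            (MemLp.of_bound ((measurable_const.indicator hT).comp
              (measurable_past s₀ hY n)).aestronglyMeasurable 1 (ae_of_all _ fun ω => by
                by_cases h : past s₀ Y n ω ∈ T <;> simp [h]))
          rw [← integral_indicator hs, ← this]
          congr with ω
          by_cases h : past s₀ Y n ω ∈ T
          · rw [Set.indicator_of_mem (show ω ∈ past s₀ Y n ⁻¹' T from h),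
              Set.indicator_of_mem h, one_mul]
          · rw [Set.indicator_of_notMem (show ω ∉ past s₀ Y n ⁻¹' T from h),
              Set.indicator_of_notMem h, zero_mul]
        rw [hsucc, integral_add ((hML n).integrable one_le_two).integrableOn
          (((hΔL n).integrable one_le_two).const_mul _).integrableOn, integral_const_mul, h0]
        simp
      · rw [hMeq]
        exact ((measurable_innovSum s₀ w hG n).comp
          (comap_measurable _)).stronglyMeasurable.aestronglyMeasurable
  -- The L¹ bound needed for Doob's convergence theorem follows from the L² bound by |m| ≤ m² + 1.
  have hbdd : ∀ n, eLpNorm (M n) 1 Pr ≤ ((C * (∑' i, w i ^ 2) + 1).toNNReal : ℝ≥0) := by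
    intro n
    have i1 := (hML n).integrable_sq
    have hsum : ∑ i ∈ Finset.range n, w i ^ 2 ≤ ∑' i, w i ^ 2 :=
      hw.sum_le_tsum _ fun i _ => sq_nonneg _
    rw [eLpNorm_one_eq_lintegral_enorm,
      ← ofReal_integral_norm_eq_lintegral_enorm ((hML n).integrable one_le_two)]
    refine ENNReal.ofReal_le_ofReal ?_
    calc ∫ ω, ‖M n ω‖ ∂Pr ≤ ∫ ω, (M n ω ^ 2 + 1) ∂Pr := by
          refine integral_mono ((hML n).integrable one_le_two).norm
            (i1.add (integrable_const 1)) fun ω => ?_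
          dsimp only
          rw [Real.norm_eq_abs, ← sq_abs]
          nlinarith [sq_nonneg (|M n ω| - 1), abs_nonneg (M n ω)]
      _ = ∫ ω, M n ω ^ 2 ∂Pr + 1 := by rw [integral_add i1 (integrable_const 1)]; simp
      _ ≤ C * (∑' i, w i ^ 2) + 1 := by
          have := mul_le_mul_of_nonneg_left hsum C.coe_nonneg
          linarith [hvar n]
  filter_upwards [hmart.submartingale.exists_ae_tendsto_of_bdd hbdd] with ω hω using hω

end Martingale

/-! ### One step of predictive recursion: posteriors, densities, measurability and drift. -/

theorem sub_sq_div_le_log {w z : ℝ} (hw : w ∈ Set.Ioo (0 : ℝ) 1) (hz : 0 ≤ z) :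
    w * (z - 1) - w ^ 2 / (1 - w) * (z ^ 2 + 1) ≤ Real.log (1 - w + w * z) := by
  obtain ⟨h0, h1⟩ := hw
  have hwz : 0 ≤ w * z := mul_nonneg h0.le hz
  have hpos : 0 < 1 - w + w * z := by linarith
  refine le_trans ?_ (Real.one_sub_inv_le_log_of_pos hpos)
  -- With u = w(z - 1), log(1 + u) ≥ 1 - 1/(1 + u) = u - u²/(1 + u); then 1 + u ≥ 1 - w and (z - 1)²
  -- ≤ z² + 1, both because z ≥ 0.
  have e : 1 - (1 - w + w * z)⁻¹ = w * (z - 1) - (w * (z - 1)) ^ 2 / (1 - w + w * z) := by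
    field_simp
    ring
  rw [e]
  have : (w * (z - 1)) ^ 2 / (1 - w + w * z) ≤ w ^ 2 / (1 - w) * (z ^ 2 + 1) := by
    rw [div_mul_eq_mul_div]
    refine div_le_div₀ (by positivity) ?_ (by linarith) (by linarith)
    nlinarith [mul_nonneg (sq_nonneg w) hz]
  linarith

theorem mixture_withDensity {k : S2 → S2 → ℝ≥0} (hk : Measurable (Function.uncurry k))
    (Ψ : Measure S2) {ρ : S2 → ℝ≥0∞} (hρ : Measurable ρ) (s : S2) :
    mixture k (Ψ.withDensity ρ) s = ∫⁻ x, ρ x * k s x ∂Ψ :=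
  lintegral_withDensity_eq_lintegral_mul _ hρ
    (hk.comp measurable_prodMk_left).coe_nnreal_ennreal

/-- The parameter enters only through a density with respect to a fixed measure, so joint
measurability is that of a parametrised integral. -/
theorem measurable_mixture_withDensity {T : Type*} [MeasurableSpace T] {k : S2 → S2 → ℝ≥0}
    (hk : Measurable (Function.uncurry k)) (Ψ : Measure S2) [SFinite Ψ] {ρ : T → S2 → ℝ≥0∞}
    (hρ : Measurable (Function.uncurry ρ)) :
    Measurable (fun q : T × S2 => mixture k (Ψ.withDensity (ρ q.1)) q.2) := by
  have h : ∀ q : T × S2, mixture k (Ψ.withDensity (ρ q.1)) q.2 = ∫⁻ x, ρ q.1 x * k q.2 x ∂Ψ :=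
    fun q => mixture_withDensity hk Ψ (hρ.comp measurable_prodMk_left) q.2
  simp only [h]
  refine Measurable.lintegral_prod_right' (f := fun r : (T × S2) × S2 => ρ r.1.1 r.2 * k r.1.2 r.2) ?_
  have h1 : Measurable (fun r : (T × S2) × S2 => ρ r.1.1 r.2) :=
    hρ.comp (f := fun r : (T × S2) × S2 => (r.1.1, r.2)) (by fun_prop)
  have h2 : Measurable (fun r : (T × S2) × S2 => k r.1.2 r.2) :=
    hk.comp (f := fun r : (T × S2) × S2 => (r.1.2, r.2)) (by fun_prop)
  exact h1.mul h2.coe_nnreal_ennreal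

/-- The posterior mixing distribution given the observation `y`. -/
noncomputable def prPosterior (k : S2 → S2 → ℝ≥0) (Ψ : Measure S2) (y : S2) : Measure S2 :=
  Ψ.withDensity (fun x => (k y x : ℝ≥0∞) / mixture k Ψ y)

theorem prStep_eq (k : S2 → S2 → ℝ≥0) (w : ℝ) (y : S2) (Ψ : Measure S2) :
    prStep k w y Ψ = ENNReal.ofReal (1 - w) • Ψ + ENNReal.ofReal w • prPosterior k Ψ y := rfl

theorem mixture_prStep (k : S2 → S2 → ℝ≥0) (w : ℝ) (y : S2) (Ψ : Measure S2) (s : S2) :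
    mixture k (prStep k w y Ψ) s =
      ENNReal.ofReal (1 - w) * mixture k Ψ s + ENNReal.ofReal w * mixture k (prPosterior k Ψ y) s := by
  simp only [prStep_eq, mixture, lintegral_add_measure, lintegral_smul_measure, smul_eq_mul]

/-- The density of the predictive recursion estimate with respect to the initial guess. -/
noncomputable def prDens (k : S2 → S2 → ℝ≥0) (w : ℕ → ℝ) (Ψ₀ : Measure S2) (y : ℕ → S2) :
    ℕ → S2 → ℝ≥0∞
  | 0 => fun _ => 1
  | n + 1 => fun x => prDens k w Ψ₀ y n x *
      (ENNReal.ofReal (1 - w n) +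
        ENNReal.ofReal (w n) * ((k (y n) x : ℝ≥0∞) / mixture k (pr k w Ψ₀ y n) (y n)))

/-- The two claims need a joint induction: the density at n + 1 contains the mixture at n, which is
measurable in the data only through its density formula. -/
theorem measurable_prDens_and_pr_eq {k : S2 → S2 → ℝ≥0} (hk : Measurable (Function.uncurry k))
    (w : ℕ → ℝ) (Ψ₀ : Measure S2) [SFinite Ψ₀] (n : ℕ) :
    Measurable (fun q : (ℕ → S2) × S2 => prDens k w Ψ₀ q.1 n q.2) ∧
      ∀ y, pr k w Ψ₀ y n = Ψ₀.withDensity (prDens k w Ψ₀ y n) := by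
  induction n with
  | zero =>
    refine ⟨measurable_const, fun y => ?_⟩
    simp only [pr, prDens]
    exact withDensity_one.symm
  | succ n ih =>
    obtain ⟨hm, he⟩ := ih
    have hmix : Measurable (fun q : (ℕ → S2) × S2 => mixture k (pr k w Ψ₀ q.1 n) q.2) := by
      simp only [he]
      exact measurable_mixture_withDensity hk Ψ₀ (ρ := fun y => prDens k w Ψ₀ y n) hm
    have h1 : Measurable (fun q : (ℕ → S2) × S2 => (k (q.1 n) q.2 : ℝ≥0∞)) :=
      (hk.comp (f := fun q : (ℕ → S2) × S2 => (q.1 n, q.2)) (by fun_prop)).coe_nnreal_ennreal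
    have h2 : Measurable (fun q : (ℕ → S2) × S2 => mixture k (pr k w Ψ₀ q.1 n) (q.1 n)) :=
      hmix.comp (f := fun q : (ℕ → S2) × S2 => (q.1, q.1 n)) (by fun_prop)
    refine ⟨hm.mul (measurable_const.add (measurable_const.mul (h1.div h2))), fun y => ?_⟩
    have hmy : Measurable (prDens k w Ψ₀ y n) := hm.comp measurable_prodMk_left
    have hky : Measurable (fun x => (k (y n) x : ℝ≥0∞) / mixture k (pr k w Ψ₀ y n) (y n)) :=
      (hk.comp measurable_prodMk_left).coe_nnreal_ennreal.div_const _
    have e : prDens k w Ψ₀ y (n + 1) = prDens k w Ψ₀ y n * ((fun _ => ENNReal.ofReal (1 - w n)) +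
        ENNReal.ofReal (w n) •
          fun x => (k (y n) x : ℝ≥0∞) / mixture k (pr k w Ψ₀ y n) (y n)) := rfl
    rw [e, withDensity_mul _ hmy (measurable_const.add (hky.const_smul _)), ← he,
      withDensity_add_left measurable_const, withDensity_const, withDensity_smul _ hky]
    rfl

theorem measurable_prDens {k : S2 → S2 → ℝ≥0} (hk : Measurable (Function.uncurry k))
    (w : ℕ → ℝ) (Ψ₀ : Measure S2) [SFinite Ψ₀] (n : ℕ) :
    Measurable (fun q : (ℕ → S2) × S2 => prDens k w Ψ₀ q.1 n q.2) :=
  (measurable_prDens_and_pr_eq hk w Ψ₀ n).1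

theorem measurable_prDens_right {k : S2 → S2 → ℝ≥0} (hk : Measurable (Function.uncurry k))
    (w : ℕ → ℝ) (Ψ₀ : Measure S2) [SFinite Ψ₀] (y : ℕ → S2) (n : ℕ) :
    Measurable (prDens k w Ψ₀ y n) :=
  (measurable_prDens hk w Ψ₀ n).comp measurable_prodMk_left

theorem pr_eq_withDensity {k : S2 → S2 → ℝ≥0} (hk : Measurable (Function.uncurry k))
    (w : ℕ → ℝ) (Ψ₀ : Measure S2) [SFinite Ψ₀] (y : ℕ → S2) (n : ℕ) :
    pr k w Ψ₀ y n = Ψ₀.withDensity (prDens k w Ψ₀ y n) :=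
  (measurable_prDens_and_pr_eq hk w Ψ₀ n).2 y

theorem measurable_mixture_pr {k : S2 → S2 → ℝ≥0} (hk : Measurable (Function.uncurry k))
    (w : ℕ → ℝ) (Ψ₀ : Measure S2) [SFinite Ψ₀] (n : ℕ) :
    Measurable (fun q : (ℕ → S2) × S2 => mixture k (pr k w Ψ₀ q.1 n) q.2) := by
  simp only [pr_eq_withDensity hk]
  exact measurable_mixture_withDensity hk Ψ₀ (ρ := fun y => prDens k w Ψ₀ y n)
    (measurable_prDens hk w Ψ₀ n)

theorem measurable_mixture_posterior_pr {k : S2 → S2 → ℝ≥0} (hk : Measurable (Function.uncurry k))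
    (w : ℕ → ℝ) (Ψ₀ : Measure S2) [SFinite Ψ₀] (n : ℕ) :
    Measurable (fun q : ((ℕ → S2) × S2) × S2 =>
      mixture k (prPosterior k (pr k w Ψ₀ q.1.1 n) q.1.2) q.2) := by
  have h1 : Measurable (fun r : ((ℕ → S2) × S2) × S2 =>
      (k r.1.2 r.2 : ℝ≥0∞) / mixture k (pr k w Ψ₀ r.1.1 n) r.1.2) :=
    (hk.comp (f := fun r : ((ℕ → S2) × S2) × S2 => (r.1.2, r.2))
      (by fun_prop)).coe_nnreal_ennreal.div ((measurable_mixture_pr hk w Ψ₀ n).comp measurable_fst)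
  have h2 : Measurable (fun r : ((ℕ → S2) × S2) × S2 => prDens k w Ψ₀ r.1.1 n r.2) :=
    (measurable_prDens hk w Ψ₀ n).comp
      (f := fun r : ((ℕ → S2) × S2) × S2 => (r.1.1, r.2)) (by fun_prop)
  have e : ∀ t : (ℕ → S2) × S2, prPosterior k (pr k w Ψ₀ t.1 n) t.2 =
      Ψ₀.withDensity (fun x => prDens k w Ψ₀ t.1 n x *
        ((k t.2 x : ℝ≥0∞) / mixture k (pr k w Ψ₀ t.1 n) t.2)) := by
    intro t
    have := withDensity_mul Ψ₀ (measurable_prDens_right hk w Ψ₀ t.1 n)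
      (g := fun x => (k t.2 x : ℝ≥0∞) / mixture k (pr k w Ψ₀ t.1 n) t.2)
      ((hk.comp measurable_prodMk_left).coe_nnreal_ennreal.div_const _)
    rw [← pr_eq_withDensity hk] at this
    exact this.symm
  simp only [e]
  exact measurable_mixture_withDensity hk Ψ₀ (ρ := fun (t : (ℕ → S2) × S2) x =>
    prDens k w Ψ₀ t.1 n x * ((k t.2 x : ℝ≥0∞) / mixture k (pr k w Ψ₀ t.1 n) t.2)) (h2.mul h1)

theorem measurable_mixture_posterior {k : S2 → S2 → ℝ≥0}
    (hk : Measurable (Function.uncurry k)) (Ψ : Measure S2) [SFinite Ψ] :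
    Measurable (fun q : S2 × S2 => mixture k (prPosterior k Ψ q.1) q.2) := by
  have h1 : Measurable (fun r : S2 × S2 => (k r.1 r.2 : ℝ≥0∞) / mixture k Ψ r.1) :=
    (hk.coe_nnreal_ennreal).div ((measurable_mixture hk Ψ).comp measurable_fst)
  exact measurable_mixture_withDensity hk Ψ (ρ := fun y x => (k y x : ℝ≥0∞) / mixture k Ψ y) h1

theorem pr_congr (k : S2 → S2 → ℝ≥0) (w : ℕ → ℝ) (Ψ₀ : Measure S2) {y z : ℕ → S2} {n : ℕ}
    (h : ∀ i < n, y i = z i) : pr k w Ψ₀ y n = pr k w Ψ₀ z n := by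
  induction n with
  | zero => rfl
  | succ n ih =>
    simp only [pr]
    rw [ih fun i hi => h i (hi.trans n.lt_succ_self), h n n.lt_succ_self]

theorem pr_truncSeq (k : S2 → S2 → ℝ≥0) (w : ℕ → ℝ) (Ψ₀ : Measure S2) (s₀ : S2) (y : ℕ → S2)
    (n : ℕ) : pr k w Ψ₀ (truncSeq s₀ n y) n = pr k w Ψ₀ y n :=
  pr_congr k w Ψ₀ fun i hi => by simp [truncSeq, hi]

/-- A step keeps the fraction 1 - w of the previous mixture. Hence positivity of f_{Ψ₀} at every
observation, a single almost sure event, keeps all later denominators positive. -/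
theorem mixture_pr_pos (k : S2 → S2 → ℝ≥0) {w : ℕ → ℝ} (hw : ∀ i, w i ∈ Set.Ioo (0 : ℝ) 1)
    (Ψ₀ : Measure S2) (y : ℕ → S2) {s : S2} (hs : 0 < mixture k Ψ₀ s) (n : ℕ) :
    0 < mixture k (pr k w Ψ₀ y n) s := by
  induction n with
  | zero => exact hs
  | succ n ih =>
    rw [pr, mixture_prStep]
    have : 0 < ENNReal.ofReal (1 - w n) := ENNReal.ofReal_pos.2 (by linarith [(hw n).2])
    exact (ENNReal.mul_pos this.ne' ih.ne').trans_le le_self_add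

namespace RegularKernel

variable {k : S2 → S2 → ℝ≥0} {X : Set S2} {ν : Measure S2} {B : ℝ≥0}

theorem isMixing_posterior (H : RegularKernel k X ν B) {Ψ : Measure S2} (hΨ : IsMixing X Ψ)
    {y : S2} (hy : 0 < mixture k Ψ y) : IsMixing X (prPosterior k Ψ y) := by
  have hk := (H.measurable_right y).coe_nnreal_ennreal
  refine ⟨⟨?_⟩, withDensity_absolutelyContinuous _ _ hΨ.null⟩
  rw [prPosterior, withDensity_apply _ MeasurableSet.univ, setLIntegral_univ]
  simp only [div_eq_mul_inv]
  rw [lintegral_mul_const _ hk]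
  exact ENNReal.mul_inv_cancel hy.ne' (H.mixture_ne_top hΨ y)

theorem isMixing_prStep (H : RegularKernel k X ν B) {Ψ : Measure S2} (hΨ : IsMixing X Ψ)
    {w : ℝ} (hw : w ∈ Set.Ioo (0 : ℝ) 1) {y : S2} (hy : 0 < mixture k Ψ y) :
    IsMixing X (prStep k w y Ψ) := by
  have hp := H.isMixing_posterior hΨ hy
  have := hΨ.isProbabilityMeasure
  have := hp.isProbabilityMeasure
  rw [prStep_eq]
  refine ⟨⟨?_⟩, ?_⟩
  · rw [Measure.add_apply, Measure.smul_apply, Measure.smul_apply, measure_univ, measure_univ,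
      smul_eq_mul, smul_eq_mul, mul_one, mul_one,
      ← ENNReal.ofReal_add (by linarith [hw.2]) hw.1.le]
    simp
  · simp [hΨ.null, hp.null]

theorem isMixing_pr (H : RegularKernel k X ν B) {Ψ₀ : Measure S2} (hΨ₀ : IsMixing X Ψ₀)
    {w : ℕ → ℝ} (hw : ∀ i, w i ∈ Set.Ioo (0 : ℝ) 1) {y : ℕ → S2}
    (hy : ∀ i, 0 < mixture k Ψ₀ (y i)) (n : ℕ) : IsMixing X (pr k w Ψ₀ y n) := by
  induction n with
  | zero => exact hΨ₀
  | succ n ih => exact H.isMixing_prStep ih (hw n) (mixture_pr_pos k hw Ψ₀ y (hy n) n)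

theorem integral_ratio_le [IsProbabilityMeasure ν] (H : RegularKernel k X ν B) {Φ Ψ : Measure S2}
    (hΦ : IsMixing X Φ) (hΨ : IsMixing X Ψ) : ∫ y, ratio k Φ Ψ y ∂ν ≤ B + 1 := by
  have h2 := H.integrable_ratio_sq hΦ hΨ
  calc ∫ y, ratio k Φ Ψ y ∂ν ≤ ∫ y, (ratio k Φ Ψ y ^ 2 + 1) ∂ν := by
        refine integral_mono (H.integrable_ratio hΦ hΨ) (h2.add (integrable_const 1)) fun y => ?_
        dsimp only
        nlinarith [sq_nonneg (ratio k Φ Ψ y - 1), ratio_nonneg (k := k) (Φ := Φ) (Ψ := Ψ) y]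
    _ = ∫ y, ratio k Φ Ψ y ^ 2 ∂ν + 1 := by rw [integral_add h2 (integrable_const 1)]; simp
    _ ≤ B + 1 := by linarith [H.integral_ratio_sq_le (ν := ν) hΦ hΨ]

/-- The expected log likelihood after one step of predictive recursion. -/
theorem le_gain_prStep [IsProbabilityMeasure ν] (H : RegularKernel k X ν B) {Ψ : Measure S2}
    (hΨ : IsMixing X Ψ) {w : ℝ} (hw : w ∈ Set.Ioo (0 : ℝ) 1) {y : S2} (hy : 0 < mixture k Ψ y) :
    w * (∫ s, ratio k (prPosterior k Ψ y) Ψ s ∂ν - 1) - w ^ 2 / (1 - w) * (B + 1) ≤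
      gain k ν (prStep k w y Ψ) Ψ := by
  have hp := H.isMixing_posterior hΨ hy
  have hs := H.isMixing_prStep hΨ hw hy
  have i1 := H.integrable_ratio (ν := ν) hp hΨ
  have i2 := H.integrable_ratio_sq (ν := ν) hp hΨ
  have j1 : Integrable (fun s => w * (ratio k (prPosterior k Ψ y) Ψ s - 1)) ν :=
    (i1.sub (integrable_const 1)).const_mul w
  have j2 : Integrable (fun s => w ^ 2 / (1 - w) * (ratio k (prPosterior k Ψ y) Ψ s ^ 2 + 1)) ν :=
    (i2.add (integrable_const 1)).const_mul _
  calc w * (∫ s, ratio k (prPosterior k Ψ y) Ψ s ∂ν - 1) - w ^ 2 / (1 - w) * (B + 1)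
      ≤ w * (∫ s, ratio k (prPosterior k Ψ y) Ψ s ∂ν - 1) -
        w ^ 2 / (1 - w) * (∫ s, ratio k (prPosterior k Ψ y) Ψ s ^ 2 ∂ν + 1) := by
        have : 0 ≤ w ^ 2 / (1 - w) := div_nonneg (sq_nonneg _) (by linarith [hw.2])
        have := mul_le_mul_of_nonneg_left (H.integral_ratio_sq_le (ν := ν) hp hΨ) this
        linarith
    _ = ∫ s, (w * (ratio k (prPosterior k Ψ y) Ψ s - 1) -
          w ^ 2 / (1 - w) * (ratio k (prPosterior k Ψ y) Ψ s ^ 2 + 1)) ∂ν := by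
        rw [integral_sub j1 j2, integral_const_mul, integral_const_mul,
          integral_sub i1 (integrable_const 1), integral_add i2 (integrable_const 1)]
        simp
    _ ≤ gain k ν (prStep k w y Ψ) Ψ := by
        refine integral_mono_ae (j1.sub j2) (H.integrable_log_ratio hs hΨ) ?_
        filter_upwards [H.ae_mixture_pos hΨ] with s hsp
        -- The update is affine in the mixing distribution, so the elementary bound for log(1 - w +
        -- wz) applies pointwise.
        have e : ratio k (prStep k w y Ψ) Ψ s = 1 - w + w * ratio k (prPosterior k Ψ y) Ψ s := by
          have h1 := H.mixture_ne_top hΨ s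
          have h2 := H.mixture_ne_top hp s
          have h3 := (ENNReal.toReal_pos hsp.ne' h1).ne'
          simp only [ratio, mixture_prStep, ENNReal.toReal_div]
          rw [ENNReal.toReal_add (ENNReal.mul_ne_top ENNReal.ofReal_ne_top h1)
            (ENNReal.mul_ne_top ENNReal.ofReal_ne_top h2), ENNReal.toReal_mul, ENNReal.toReal_mul,
            ENNReal.toReal_ofReal (by linarith [hw.2]), ENNReal.toReal_ofReal hw.1.le]
          field_simp
        rw [e]
        exact sub_sq_div_le_log hw (ratio_nonneg s)

/-- Let g(x) be the ν-mean of k(y ∣ x)/f_Ψ(y). Its Ψ-mean is 1, and by Tonelli the double integral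
is the Ψ-mean of g², so Jensen applies. -/
theorem one_le_lintegral_posterior [IsProbabilityMeasure ν] (H : RegularKernel k X ν B)
    {Ψ : Measure S2} (hΨ : IsMixing X Ψ) :
    1 ≤ ∫⁻ y, ∫⁻ s, mixture k (prPosterior k Ψ y) s / mixture k Ψ s ∂ν ∂ν := by
  have := hΨ.isProbabilityMeasure
  have hmix := measurable_mixture H.measurable Ψ
  let g : S2 → ℝ≥0∞ := fun x => ∫⁻ y, (k y x : ℝ≥0∞) / mixture k Ψ y ∂ν
  have hq : Measurable (fun q : S2 × S2 => (k q.1 q.2 : ℝ≥0∞) / mixture k Ψ q.1) :=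
    H.measurable.coe_nnreal_ennreal.div (hmix.comp measurable_fst)
  have hq' : Measurable (fun q : S2 × S2 => (k q.2 q.1 : ℝ≥0∞) / mixture k Ψ q.2) :=
    hq.comp measurable_swap
  have hql : ∀ x, Measurable fun y => (k y x : ℝ≥0∞) / mixture k Ψ y := fun x =>
    (H.measurable_left x).coe_nnreal_ennreal.div hmix
  have hg : Measurable g := hq'.lintegral_prod_right'
  have hg1 : ∫⁻ x, g x ∂Ψ = 1 := by
    rw [lintegral_lintegral_swap hq'.aemeasurable]
    calc ∫⁻ y, ∫⁻ x, (k y x : ℝ≥0∞) / mixture k Ψ y ∂Ψ ∂ν = ∫⁻ _, 1 ∂ν := by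
          refine lintegral_congr_ae ?_
          filter_upwards [H.ae_mixture_pos hΨ] with y hy
          simp only [div_eq_mul_inv]
          rw [lintegral_mul_const _ (H.measurable_right y).coe_nnreal_ennreal]
          exact ENNReal.mul_inv_cancel hy.ne' (H.mixture_ne_top hΨ y)
      _ = 1 := by simp
  calc (1 : ℝ≥0∞) = (∫⁻ x, g x ∂Ψ) ^ 2 := by rw [hg1, one_pow]
    _ ≤ ∫⁻ x, g x ^ 2 ∂Ψ := sq_lintegral_le_lintegral_sq Ψ hg.aemeasurable
    _ = ∫⁻ x, ∫⁻ y, (k y x : ℝ≥0∞) / mixture k Ψ y * g x ∂ν ∂Ψ := by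
        refine lintegral_congr fun x => ?_
        rw [lintegral_mul_const _ (hql x), sq]
    _ = ∫⁻ y, ∫⁻ x, (k y x : ℝ≥0∞) / mixture k Ψ y * g x ∂Ψ ∂ν :=
        lintegral_lintegral_swap (hq'.mul (hg.comp measurable_fst)).aemeasurable
    _ = ∫⁻ y, ∫⁻ s, mixture k (prPosterior k Ψ y) s / mixture k Ψ s ∂ν ∂ν := by
        refine lintegral_congr fun y => ?_
        have hky : Measurable fun x => (k y x : ℝ≥0∞) / mixture k Ψ y :=
          (H.measurable_right y).coe_nnreal_ennreal.div_const _
        have e : ∀ x, (k y x : ℝ≥0∞) / mixture k Ψ y * g x = ∫⁻ s, (k y x : ℝ≥0∞) / mixture k Ψ y *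
            ((k s x : ℝ≥0∞) / mixture k Ψ s) ∂ν := fun x => (lintegral_const_mul _ (hql x)).symm
        simp only [e]
        rw [lintegral_lintegral_swap ((hky.comp measurable_fst).mul hq').aemeasurable]
        refine lintegral_congr fun s => ?_
        rw [prPosterior, mixture_withDensity H.measurable Ψ hky]
        simp only [div_eq_mul_inv, ← mul_assoc]
        rw [lintegral_mul_const]
        have := (H.measurable_right s).coe_nnreal_ennreal
        simp only [div_eq_mul_inv] at hky
        exact hky.mul this

/-- The mean improvement of the likelihood is nonnegative. -/
theorem one_le_integral_posterior [IsProbabilityMeasure ν] (H : RegularKernel k X ν B)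
    {Ψ : Measure S2} (hΨ : IsMixing X Ψ) :
    1 ≤ ∫ y, ∫ s, ratio k (prPosterior k Ψ y) Ψ s ∂ν ∂ν := by
  have := hΨ.isProbabilityMeasure
  have hm : StronglyMeasurable (fun y => ∫ s, ratio k (prPosterior k Ψ y) Ψ s ∂ν) := by
    refine StronglyMeasurable.integral_prod_right (f := fun y s => ratio k (prPosterior k Ψ y) Ψ s) ?_
    exact (((measurable_mixture_posterior H.measurable Ψ).div
      ((measurable_mixture H.measurable Ψ).comp measurable_snd)).ennreal_toReal).stronglyMeasurable
  have hnn : ∀ y, 0 ≤ ∫ s, ratio k (prPosterior k Ψ y) Ψ s ∂ν := fun y =>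
    integral_nonneg fun s => ratio_nonneg s
  have hint : Integrable (fun y => ∫ s, ratio k (prPosterior k Ψ y) Ψ s ∂ν) ν := by
    refine Integrable.of_bound hm.aestronglyMeasurable (B + 1) ?_
    filter_upwards [H.ae_mixture_pos hΨ] with y hy
    rw [Real.norm_of_nonneg (hnn y)]
    exact H.integral_ratio_le (H.isMixing_posterior hΨ hy) hΨ
  rw [← ENNReal.ofReal_le_ofReal_iff (integral_nonneg hnn),
    ofReal_integral_eq_lintegral_ofReal hint (ae_of_all _ hnn), ENNReal.ofReal_one]
  refine (H.one_le_lintegral_posterior hΨ).trans (le_of_eq (lintegral_congr_ae ?_))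
  filter_upwards [H.ae_mixture_pos hΨ] with y hy
  have hp := H.isMixing_posterior hΨ hy
  rw [ofReal_integral_eq_lintegral_ofReal (H.integrable_ratio hp hΨ)
    (ae_of_all _ fun s => ratio_nonneg s)]
  refine lintegral_congr_ae ?_
  filter_upwards [H.ae_mixture_pos hΨ] with s hs
  rw [H.ofReal_ratio hp hs]

theorem isMixing_dirac (H : RegularKernel k X ν B) {x : S2} (hx : x ∈ X) :
    IsMixing X (Measure.dirac x) :=
  ⟨inferInstance, by rw [Measure.dirac_apply' _ H.isClosed.measurableSet.compl]; simp [hx]⟩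

/-- The second moment under `Φ` of the likelihood of the parameter. -/
theorem lintegral_likelihood_sq_le [IsProbabilityMeasure ν] (H : RegularKernel k X ν B)
    {Φ Ψ : Measure S2} (hΦ : IsMixing X Φ) (hΨ : IsMixing X Ψ) :
    ∫⁻ y, ∫⁻ x, ((k y x : ℝ≥0∞) / mixture k Ψ y) ^ 2 ∂Φ ∂ν ≤ B := by
  have := hΨ.isProbabilityMeasure
  have := hΦ.isProbabilityMeasure
  rw [lintegral_lintegral_swap]
  · calc _ ≤ ∫⁻ _, B ∂Φ := by
          refine lintegral_mono_ae ?_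
          filter_upwards [hΦ.ae_mem] with x hx
          -- A single kernel k(· ∣ x) is the mixture over a point mass, so the bound for mixture
          -- ratios covers it.
          have := H.lintegral_mixture_div_sq_le (H.isMixing_dirac hx) hΨ
          have e : ∀ y, mixture k (Measure.dirac x) y = k y x := fun y => lintegral_dirac x _
          simpa only [e] using this
      _ = B := by simp
  · exact ((H.measurable.coe_nnreal_ennreal.div
      ((measurable_mixture H.measurable Ψ).comp measurable_fst)).pow_const 2).aemeasurable

end RegularKernel

theorem prDens_ne_zero (k : S2 → S2 → ℝ≥0) {w : ℕ → ℝ} (hw : ∀ i, w i ∈ Set.Ioo (0 : ℝ) 1)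
    (Ψ₀ : Measure S2) (y : ℕ → S2) (n : ℕ) (x : S2) : prDens k w Ψ₀ y n x ≠ 0 := by
  induction n with
  | zero => exact one_ne_zero
  | succ n ih =>
    have : 0 < ENNReal.ofReal (1 - w n) := ENNReal.ofReal_pos.2 (by linarith [(hw n).2])
    exact mul_ne_zero ih (this.trans_le le_self_add).ne'

theorem prDens_ne_top (k : S2 → S2 → ℝ≥0) {w : ℕ → ℝ} (hw : ∀ i, w i ∈ Set.Ioo (0 : ℝ) 1)
    (Ψ₀ : Measure S2) {y : ℕ → S2} (hy : ∀ i, 0 < mixture k Ψ₀ (y i)) (n : ℕ) (x : S2) :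
    prDens k w Ψ₀ y n x ≠ ∞ := by
  induction n with
  | zero => exact ENNReal.one_ne_top
  | succ n ih =>
    exact ENNReal.mul_ne_top ih (ENNReal.add_ne_top.2 ⟨ENNReal.ofReal_ne_top,
      ENNReal.mul_ne_top ENNReal.ofReal_ne_top (ENNReal.div_ne_top ENNReal.coe_ne_top
        (mixture_pr_pos k hw Ψ₀ y (hy n) n).ne')⟩)

/-- The expected log density of the predictive recursion estimate with respect to the initial
guess. -/
noncomputable def logDens (k : S2 → S2 → ℝ≥0) (w : ℕ → ℝ) (Ψ₀ Φ : Measure S2) (y : ℕ → S2)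
    (n : ℕ) : ℝ :=
  ∫ x, Real.log (prDens k w Ψ₀ y n x).toReal ∂Φ

namespace RegularKernel

variable {k : S2 → S2 → ℝ≥0} {X : Set S2} {ν : Measure S2} {B : ℝ≥0}

theorem exists_bound_div (H : RegularKernel k X ν B) {Ψ : Measure S2} {y : S2}
    (hy : 0 < mixture k Ψ y) :
    ∃ K : ℝ≥0, ∀ x ∈ X, (k y x : ℝ≥0∞) / mixture k Ψ y ≤ K := by
  obtain ⟨M, hM⟩ := H.exists_bound y
  refine ⟨((M : ℝ≥0∞) / mixture k Ψ y).toNNReal, fun x hx => ?_⟩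
  rw [ENNReal.coe_toNNReal (ENNReal.div_ne_top ENNReal.coe_ne_top hy.ne')]
  gcongr
  exact hM x hx

theorem integral_likelihood (H : RegularKernel k X ν B) (Φ : Measure S2) {Ψ : Measure S2}
    {y : S2} (hy : 0 < mixture k Ψ y) :
    ∫ x, ((k y x : ℝ≥0∞) / mixture k Ψ y).toReal ∂Φ = ratio k Φ Ψ y := by
  have hk := (H.measurable_right y).coe_nnreal_ennreal
  rw [integral_toReal (hk.div_const _).aemeasurable
    (ae_of_all _ fun x => (ENNReal.div_ne_top ENNReal.coe_ne_top hy.ne').lt_top), ratio]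
  simp only [div_eq_mul_inv]
  rw [lintegral_mul_const _ hk]
  rfl

/-- The expected log density after one step of predictive recursion. -/
theorem logDens_succ (H : RegularKernel k X ν B) {Ψ₀ Φ : Measure S2} [SFinite Ψ₀]
    (hΦ : IsMixing X Φ) {w : ℕ → ℝ} (hw : ∀ i, w i ∈ Set.Ioo (0 : ℝ) 1) {y : ℕ → S2}
    (hy : ∀ i, 0 < mixture k Ψ₀ (y i)) (n : ℕ) :
    Integrable (fun x => Real.log (prDens k w Ψ₀ y n x).toReal) Φ ∧
    logDens k w Ψ₀ Φ y n + w n * (ratio k Φ (pr k w Ψ₀ y n) (y n) - 1) -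
      w n ^ 2 / (1 - w n) * ((∫⁻ x, ((k (y n) x : ℝ≥0∞) /
        mixture k (pr k w Ψ₀ y n) (y n)) ^ 2 ∂Φ).toReal + 1) ≤ logDens k w Ψ₀ Φ y (n + 1) := by
  have := hΦ.isProbabilityMeasure
  let u : ℕ → S2 → ℝ := fun n x =>
    ((k (y n) x : ℝ≥0∞) / mixture k (pr k w Ψ₀ y n) (y n)).toReal
  have hpos : ∀ n, 0 < mixture k (pr k w Ψ₀ y n) (y n) := fun n =>
    mixture_pr_pos k hw Ψ₀ y (hy n) n
  have hu0 : ∀ n x, 0 ≤ u n x := fun n x => ENNReal.toReal_nonneg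
  have hum : ∀ n, Measurable (u n) := fun n =>
    ((H.measurable_right (y n)).coe_nnreal_ennreal.div_const _).ennreal_toReal
  -- For fixed data the likelihood factor is bounded on the compact set X, so all integrals over x
  -- below exist without moment estimates.
  have hub : ∀ n, ∃ K : ℝ, ∀ x ∈ X, u n x ≤ K := fun n => by
    obtain ⟨K, hK⟩ := H.exists_bound_div (hpos n)
    exact ⟨K, fun x hx => ENNReal.toReal_le_coe_of_le_coe (hK x hx)⟩
  have hui : ∀ n, Integrable (u n) Φ := fun n => by
    obtain ⟨K, hK⟩ := hub n
    refine Integrable.of_bound (hum n).aestronglyMeasurable K ?_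
    filter_upwards [hΦ.ae_mem] with x hx
    rw [Real.norm_of_nonneg (hu0 n x)]
    exact hK x hx
  have hui2 : ∀ n, Integrable (fun x => u n x ^ 2) Φ := fun n => by
    obtain ⟨K, hK⟩ := hub n
    refine Integrable.of_bound ((hum n).pow_const 2).aestronglyMeasurable (K ^ 2) ?_
    filter_upwards [hΦ.ae_mem] with x hx
    rw [Real.norm_of_nonneg (sq_nonneg _)]
    exact pow_le_pow_left₀ (hu0 n x) (hK x hx) 2
  -- The density is updated by a factor, so its log has additive increments to which the elementary
  -- bound applies.
  have hstep : ∀ n x, Real.log (prDens k w Ψ₀ y (n + 1) x).toReal =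
      Real.log (prDens k w Ψ₀ y n x).toReal + Real.log (1 - w n + w n * u n x) := fun n x => by
    have h1 := ENNReal.toReal_pos (prDens_ne_zero k hw Ψ₀ y n x) (prDens_ne_top k hw Ψ₀ hy n x)
    have h2 : 0 < 1 - w n + w n * u n x := by
      have := mul_nonneg (hw n).1.le (hu0 n x)
      linarith [(hw n).2]
    rw [← Real.log_mul h1.ne' h2.ne', prDens, ENNReal.toReal_mul, ENNReal.toReal_add
      ENNReal.ofReal_ne_top (ENNReal.mul_ne_top ENNReal.ofReal_ne_top
        (ENNReal.div_ne_top ENNReal.coe_ne_top (hpos n).ne')), ENNReal.toReal_mul,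
      ENNReal.toReal_ofReal (by linarith [(hw n).2]), ENNReal.toReal_ofReal (hw n).1.le]
  have hli : ∀ n, Integrable (fun x => Real.log (1 - w n + w n * u n x)) Φ := fun n => by
    have hwn := hw n
    refine ((integrable_const |Real.log (1 - w n)|).add (hui n)).mono'
      (((hum n).const_mul _).const_add _).log.aestronglyMeasurable (ae_of_all _ fun x => ?_)
    have h1 := mul_nonneg hwn.1.le (hu0 n x)
    have h2 : 0 < 1 - w n := by linarith [hwn.2]
    rw [Real.norm_eq_abs, abs_le]
    constructor
    · have h3 := Real.log_le_log h2 (show 1 - w n ≤ 1 - w n + w n * u n x by linarith)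
      have h4 := neg_abs_le (Real.log (1 - w n))
      have := hu0 n x
      simp only [Pi.add_apply]
      linarith
    · have h3 := Real.log_le_sub_one_of_pos (show 0 < 1 - w n + w n * u n x by linarith)
      have h4 : w n * u n x ≤ u n x := mul_le_of_le_one_left (hu0 n x) hwn.2.le
      have h5 := abs_nonneg (Real.log (1 - w n))
      simp only [Pi.add_apply]
      linarith [hwn.1]
  have hint : ∀ n, Integrable (fun x => Real.log (prDens k w Ψ₀ y n x).toReal) Φ := by
    intro n
    induction n with
    | zero => simp [prDens]
    | succ n ih =>
      simp only [hstep]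
      exact ih.add (hli n)
  refine ⟨hint n, ?_⟩
  have j1 : Integrable (fun x => w n * (u n x - 1)) Φ :=
    ((hui n).sub (integrable_const 1)).const_mul _
  have j2 : Integrable (fun x => w n ^ 2 / (1 - w n) * (u n x ^ 2 + 1)) Φ :=
    ((hui2 n).add (integrable_const 1)).const_mul _
  have hV : ∫ x, u n x ^ 2 ∂Φ = (∫⁻ x, ((k (y n) x : ℝ≥0∞) /
        mixture k (pr k w Ψ₀ y n) (y n)) ^ 2 ∂Φ).toReal := by
    rw [← integral_toReal (((H.measurable_right (y n)).coe_nnreal_ennreal.div_const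
      _).pow_const 2).aemeasurable (ae_of_all _ fun x => (ENNReal.pow_ne_top
        (ENNReal.div_ne_top ENNReal.coe_ne_top (hpos n).ne')).lt_top)]
    simp only [u, ENNReal.toReal_pow]
  have hr : ∫ x, u n x ∂Φ = ratio k Φ (pr k w Ψ₀ y n) (y n) := H.integral_likelihood Φ (hpos n)
  have key : ∫ x, (w n * (u n x - 1) - w n ^ 2 / (1 - w n) * (u n x ^ 2 + 1)) ∂Φ ≤
      ∫ x, Real.log (1 - w n + w n * u n x) ∂Φ :=
    integral_mono (j1.sub j2) (hli n) fun x => sub_sq_div_le_log (hw n) (hu0 n x)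
  rw [integral_sub j1 j2, integral_const_mul, integral_const_mul,
    integral_sub (hui n) (integrable_const 1), integral_add (hui2 n) (integrable_const 1),
    hV, hr] at key
  have e : logDens k w Ψ₀ Φ y (n + 1) =
      logDens k w Ψ₀ Φ y n + ∫ x, Real.log (1 - w n + w n * u n x) ∂Φ := by
    rw [logDens, logDens, ← integral_add (hint n) (hli n)]
    simp only [hstep]
  simp only [integral_const, probReal_univ, smul_eq_mul, one_mul] at key
  rw [e]
  linarith

/-- Since log t ≤ t, it suffices to integrate the density itself, which has total mass 1 under Ψ₀
and hence at most M under Φ. This ceiling is what a persistent gap in gain would break. -/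
theorem logDens_le (H : RegularKernel k X ν B) {Ψ₀ Φ : Measure S2} (hΨ₀ : IsMixing X Ψ₀)
    (hΦ : IsMixing X Φ) {M : ℝ≥0} (hM : Φ ≤ M • Ψ₀) {w : ℕ → ℝ}
    (hw : ∀ i, w i ∈ Set.Ioo (0 : ℝ) 1) {y : ℕ → S2}
    (hy : ∀ i, 0 < mixture k Ψ₀ (y i)) (n : ℕ) : logDens k w Ψ₀ Φ y n ≤ M := by
  have := hΨ₀.isProbabilityMeasure
  have hm := measurable_prDens_right H.measurable w Ψ₀ y n
  have h1 : ∫⁻ x, prDens k w Ψ₀ y n x ∂Ψ₀ = 1 := by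
    have := (H.isMixing_pr hΨ₀ hw hy n).isProbabilityMeasure.measure_univ
    rwa [pr_eq_withDensity H.measurable, withDensity_apply _ MeasurableSet.univ,
      setLIntegral_univ] at this
  have h2 : ∫⁻ x, prDens k w Ψ₀ y n x ∂Φ ≤ M := by
    calc ∫⁻ x, prDens k w Ψ₀ y n x ∂Φ ≤ ∫⁻ x, prDens k w Ψ₀ y n x ∂(M • Ψ₀) :=
          lintegral_mono' hM le_rfl
      _ = M := by rw [lintegral_smul_measure, h1]; simp [ENNReal.smul_def]
  calc logDens k w Ψ₀ Φ y n ≤ ∫ x, (prDens k w Ψ₀ y n x).toReal ∂Φ := by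
        refine integral_mono (H.logDens_succ hΦ hw hy n).1
          (integrable_toReal_of_lintegral_ne_top hm.aemeasurable
            (h2.trans_lt ENNReal.coe_lt_top).ne) fun x => ?_
        exact (Real.log_le_sub_one_of_pos (ENNReal.toReal_pos (prDens_ne_zero k hw Ψ₀ y n x)
          (prDens_ne_top k hw Ψ₀ hy n x))).trans (by linarith)
    _ = (∫⁻ x, prDens k w Ψ₀ y n x ∂Φ).toReal :=
        integral_toReal hm.aemeasurable
          (ae_of_all _ fun x => (prDens_ne_top k hw Ψ₀ hy n x).lt_top)
    _ ≤ M := ENNReal.toReal_le_coe_of_le_coe h2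

end RegularKernel

/-! ### Approximating a mixing distribution by ones with bounded density. -/

section Smoothing

variable {α : Type*} [PseudoMetricSpace α] [MeasurableSpace α]

/-- The kernel of averaging over balls of radius `r`. -/
noncomputable def ballKernel (μ : Measure α) (r : ℝ) (x z : α) : ℝ≥0∞ :=
  (Metric.ball z r).indicator (fun _ => (μ (Metric.ball z r))⁻¹) x

/-- The average of the normalised restrictions of `μ` to the balls of radius `r`, with respect to
the distribution `Ψ` of the centre. -/
noncomputable def smoothing (μ Ψ : Measure α) (r : ℝ) : Measure α :=
  μ.withDensity fun x => ∫⁻ z, ballKernel μ r x z ∂Ψ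

theorem measure_ball_pos_of_mem_support {μ : Measure α} {z : α} (hz : z ∈ μ.support) {r : ℝ}
    (hr : 0 < r) : 0 < μ (Metric.ball z r) :=
  (Measure.mem_support_iff_forall z).1 hz _ (Metric.ball_mem_nhds z hr)

theorem smoothing_le {μ Ψ : Measure α} [SFinite μ] [IsProbabilityMeasure Ψ]
    (hΨ : ∀ᵐ z ∂Ψ, z ∈ μ.support) {r : ℝ} {M : ℝ≥0}
    (hM : ∀ z ∈ μ.support, (μ (Metric.ball z r))⁻¹ ≤ M) : smoothing μ Ψ r ≤ M • μ := by
  have e : M • μ = μ.withDensity fun _ => (M : ℝ≥0∞) := by rw [withDensity_const]; rfl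
  rw [e]
  refine withDensity_mono (ae_of_all _ fun x => ?_)
  calc ∫⁻ z, ballKernel μ r x z ∂Ψ ≤ ∫⁻ _, M ∂Ψ := by
        refine lintegral_mono_ae ?_
        filter_upwards [hΨ] with z hz
        refine le_trans ?_ (hM z hz)
        exact Set.indicator_le_self' (fun _ _ => zero_le) x
    _ = M := by simp

/-- Cover the compact support by finitely many balls of radius r/2 centred in it, all of positive
mass. A ball of radius r centred in the support contains one of them; the sum of the inverse masses
bounds their maximum. -/
theorem exists_inv_measure_ball_le [CompactSpace α] (μ : Measure α) {r : ℝ} (hr : 0 < r) :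
    ∃ M : ℝ≥0, ∀ z ∈ μ.support, (μ (Metric.ball z r))⁻¹ ≤ M := by
  have hc : IsCompact μ.support := Measure.isClosed_support.isCompact
  obtain ⟨t, ht, hcov⟩ := hc.elim_nhds_subcover (fun z => Metric.ball z (r / 2))
    fun z _ => Metric.ball_mem_nhds z (half_pos hr)
  refine ⟨∑ c ∈ t, (μ (Metric.ball c (r / 2)))⁻¹.toNNReal, fun z hz => ?_⟩
  obtain ⟨c, hct, hzc⟩ := Set.mem_iUnion₂.1 (hcov hz)
  have hpos := measure_ball_pos_of_mem_support (ht c hct) (half_pos hr)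
  calc (μ (Metric.ball z r))⁻¹ ≤ (μ (Metric.ball c (r / 2)))⁻¹ := by
        refine ENNReal.inv_le_inv.2 (measure_mono (Metric.ball_subset_ball' ?_))
        rw [Metric.mem_ball] at hzc
        rw [dist_comm]
        linarith
    _ = ((μ (Metric.ball c (r / 2)))⁻¹.toNNReal : ℝ≥0) :=
        (ENNReal.coe_toNNReal (ENNReal.inv_ne_top.2 hpos.ne')).symm
    _ ≤ _ := by
        exact_mod_cast Finset.single_le_sum
          (f := fun c => (μ (Metric.ball c (r / 2)))⁻¹.toNNReal) (fun _ _ => zero_le) hct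

variable [OpensMeasurableSpace α]

theorem lintegral_ballKernel (μ : Measure α) (r : ℝ) (z : α) (φ : α → ℝ≥0∞) (hφ : Measurable φ) :
    ∫⁻ x, ballKernel μ r x z * φ x ∂μ =
      (μ (Metric.ball z r))⁻¹ * ∫⁻ x in Metric.ball z r, φ x ∂μ := by
  rw [← lintegral_const_mul _ hφ, ← lintegral_indicator Metric.isOpen_ball.measurableSet]
  refine lintegral_congr fun x => ?_
  by_cases h : x ∈ Metric.ball z r
  · simp only [ballKernel, Set.indicator_of_mem h]
  · simp only [ballKernel, Set.indicator_of_notMem h, zero_mul]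

theorem inv_mul_setLIntegral_ball_le {μ : Measure α} [IsFiniteMeasure μ] {z : α} {r : ℝ}
    (h0 : 0 < μ (Metric.ball z r)) {φ : α → ℝ≥0∞} {c : ℝ≥0∞}
    (h : ∀ᵐ x ∂μ, x ∈ Metric.ball z r → φ x ≤ c) :
    (μ (Metric.ball z r))⁻¹ * ∫⁻ x in Metric.ball z r, φ x ∂μ ≤ c := by
  calc _ ≤ (μ (Metric.ball z r))⁻¹ * ∫⁻ x in Metric.ball z r, c ∂μ := by
        refine mul_le_mul_right ?_ _
        exact lintegral_mono_ae ((ae_restrict_iff' Metric.isOpen_ball.measurableSet).2 h)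
    _ = c := by
        rw [setLIntegral_const, mul_comm c, ← mul_assoc,
          ENNReal.inv_mul_cancel h0.ne' (measure_ne_top _ _), one_mul]

theorem le_inv_mul_setLIntegral_ball {μ : Measure α} [IsFiniteMeasure μ] {z : α} {r : ℝ}
    (h0 : 0 < μ (Metric.ball z r)) {φ : α → ℝ≥0∞} {c : ℝ≥0∞}
    (h : ∀ᵐ x ∂μ, x ∈ Metric.ball z r → c ≤ φ x) :
    c ≤ (μ (Metric.ball z r))⁻¹ * ∫⁻ x in Metric.ball z r, φ x ∂μ := by
  calc c = (μ (Metric.ball z r))⁻¹ * ∫⁻ x in Metric.ball z r, c ∂μ := by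
        rw [setLIntegral_const, mul_comm c, ← mul_assoc,
          ENNReal.inv_mul_cancel h0.ne' (measure_ne_top _ _), one_mul]
    _ ≤ _ := by
        refine mul_le_mul_right ?_ _
        exact lintegral_mono_ae ((ae_restrict_iff' Metric.isOpen_ball.measurableSet).2 h)

/-- Convergence at every point of the support, by continuity there; values of φ off the support do
not matter because μ is carried by it. -/
theorem tendsto_inv_mul_setLIntegral_ball {μ : Measure α} [IsFiniteMeasure μ]
    (hμ : ∀ᵐ x ∂μ, x ∈ μ.support) {z : α} (hz : z ∈ μ.support) {φ : α → ℝ≥0}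
    (hφ : ContinuousOn φ μ.support) {r : ℕ → ℝ} (hr0 : ∀ n, 0 < r n)
    (hr : Tendsto r atTop (𝓝 0)) :
    Tendsto (fun n => (μ (Metric.ball z (r n)))⁻¹ * ∫⁻ x in Metric.ball z (r n), φ x ∂μ) atTop
      (𝓝 (φ z)) := by
  rw [ENNReal.tendsto_nhds ENNReal.coe_ne_top]
  intro ε hε
  have hc : ContinuousWithinAt (fun x => (φ x : ℝ≥0∞)) μ.support z :=
    (ENNReal.continuous_coe.comp_continuousOn hφ) z hz
  have hev := (ENNReal.tendsto_nhds ENNReal.coe_ne_top).1 hc ε hε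
  obtain ⟨δ, hδ, hsub⟩ := Metric.mem_nhdsWithin_iff.1 hev
  filter_upwards [hr.eventually (gt_mem_nhds hδ)] with n hn
  have h0 := measure_ball_pos_of_mem_support hz (hr0 n)
  have hx : ∀ᵐ x ∂μ, x ∈ Metric.ball z (r n) →
      (φ x : ℝ≥0∞) ∈ Set.Icc ((φ z : ℝ≥0∞) - ε) (φ z + ε) := by
    filter_upwards [hμ] with x hx hxb
    exact hsub ⟨Metric.ball_subset_ball hn.le hxb, hx⟩
  exact ⟨le_inv_mul_setLIntegral_ball h0 (hx.mono fun x h hb => (h hb).1),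
    inv_mul_setLIntegral_ball_le h0 (hx.mono fun x h hb => (h hb).2)⟩

variable [SecondCountableTopology α]

theorem measurable_ballKernel (μ : Measure α) [SFinite μ] (r : ℝ) :
    Measurable (Function.uncurry (ballKernel μ r)) := by
  have hs : MeasurableSet {q : α × α | dist q.1 q.2 < r} :=
    measurableSet_lt measurable_dist measurable_const
  have hs' : MeasurableSet {q : α × α | dist q.2 q.1 < r} :=
    measurableSet_lt (measurable_dist.comp measurable_swap) measurable_const
  have hm : Measurable fun z => μ (Metric.ball z r) := measurable_measure_prodMk_left hs'
  exact (hm.inv.comp measurable_snd).indicator hs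

theorem lintegral_smoothing (μ Ψ : Measure α) [SFinite μ] [SFinite Ψ] (r : ℝ) {φ : α → ℝ≥0∞}
    (hφ : Measurable φ) :
    ∫⁻ x, φ x ∂(smoothing μ Ψ r) =
      ∫⁻ z, (μ (Metric.ball z r))⁻¹ * ∫⁻ x in Metric.ball z r, φ x ∂μ ∂Ψ := by
  have hK := measurable_ballKernel μ r
  have hd : Measurable fun x => ∫⁻ z, ballKernel μ r x z ∂Ψ := hK.lintegral_prod_right'
  rw [smoothing, lintegral_withDensity_eq_lintegral_mul _ hd hφ]
  simp only [← lintegral_ballKernel μ r _ φ hφ]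
  rw [lintegral_lintegral_swap ((hK.comp measurable_swap).mul
    (hφ.comp measurable_snd)).aemeasurable]
  refine lintegral_congr fun x => ?_
  exact (lintegral_mul_const _ (hK.comp measurable_prodMk_left)).symm

end Smoothing

namespace RegularKernel

variable {k : S2 → S2 → ℝ≥0} {X : Set S2} {ν : Measure S2} {B : ℝ≥0}

theorem isMixing_smoothing {Ψ₀ Ψ : Measure S2} (hΨ₀ : IsMixing X Ψ₀) (hX : Ψ₀.support = X)
    (hΨ : IsMixing X Ψ) {r : ℝ} (hr : 0 < r) : IsMixing X (smoothing Ψ₀ Ψ r) := by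
  have := hΨ₀.isProbabilityMeasure
  have := hΨ.isProbabilityMeasure
  refine ⟨⟨?_⟩, withDensity_absolutelyContinuous _ _ hΨ₀.null⟩
  rw [← lintegral_one, lintegral_smoothing _ _ _ measurable_const]
  calc _ = ∫⁻ _, 1 ∂Ψ := by
        refine lintegral_congr_ae ?_
        filter_upwards [hΨ.ae_mem] with z hz
        rw [← hX] at hz
        rw [setLIntegral_one]
        exact ENNReal.inv_mul_cancel (measure_ball_pos_of_mem_support hz hr).ne'
          (measure_ne_top _ _)
    _ = 1 := by simp

theorem tendsto_mixture_smoothing (H : RegularKernel k X ν B) {Ψ₀ Ψ : Measure S2}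
    (hΨ₀ : IsMixing X Ψ₀) (hX : Ψ₀.support = X) (hΨ : IsMixing X Ψ) {r : ℕ → ℝ}
    (hr0 : ∀ n, 0 < r n) (hr : Tendsto r atTop (𝓝 0)) (y : S2) :
    Tendsto (fun n => mixture k (smoothing Ψ₀ Ψ (r n)) y) atTop (𝓝 (mixture k Ψ y)) := by
  have := hΨ₀.isProbabilityMeasure
  have := hΨ.isProbabilityMeasure
  have hk := (H.measurable_right y).coe_nnreal_ennreal
  have hae := hΨ₀.ae_mem
  obtain ⟨M, hM⟩ := H.exists_bound y
  simp only [mixture, lintegral_smoothing _ _ _ hk]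
  -- For fixed y the ball means of k(y ∣ ·) are bounded by its maximum on X, so dominated
  -- convergence in the centre applies.
  refine tendsto_lintegral_of_dominated_convergence' (fun _ => (M : ℝ≥0∞)) (fun n => ?_)
    (fun n => ?_) (by simp) ?_
  · have hK := measurable_ballKernel Ψ₀ (r n)
    simp only [← lintegral_ballKernel Ψ₀ (r n) _ _ hk]
    exact (Measurable.lintegral_prod_right' (f := fun q : S2 × S2 =>
      ballKernel Ψ₀ (r n) q.2 q.1 * k y q.2)
      ((hK.comp measurable_swap).mul (hk.comp measurable_snd))).aemeasurable
  · filter_upwards [hΨ.ae_mem] with z hz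
    rw [← hX] at hz
    refine inv_mul_setLIntegral_ball_le (measure_ball_pos_of_mem_support hz (hr0 n)) ?_
    filter_upwards [hae] with x hx _
    exact_mod_cast hM x hx
  · filter_upwards [hΨ.ae_mem] with z hz
    rw [← hX] at hz hae
    exact tendsto_inv_mul_setLIntegral_ball hae hz (hX ▸ H.continuousOn y) hr0 hr

end RegularKernel

/-! ### Deterministic sequences. -/

/-- A sequence which is bounded above and whose increments exceed the terms of a convergent series
converges. -/
theorem exists_tendsto_of_le_increment {a d : ℕ → ℝ} {K l : ℝ} (ha : ∀ n, a n ≤ K)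
    (hd : Tendsto (fun n => ∑ i ∈ Finset.range n, d i) atTop (𝓝 l))
    (h : ∀ n, a n + d n ≤ a (n + 1)) : ∃ b, Tendsto a atTop (𝓝 b) := by
  have hmono : Monotone fun n => a n - ∑ i ∈ Finset.range n, d i := by
    refine monotone_nat_of_le_succ fun n => ?_
    rw [Finset.sum_range_succ]
    linarith [h n]
  obtain ⟨D, hD⟩ := hd.bddBelow_range
  have hbdd : BddAbove (Set.range fun n => a n - ∑ i ∈ Finset.range n, d i) := by
    refine ⟨K - D, ?_⟩
    rintro _ ⟨n, rfl⟩
    have := hD (Set.mem_range_self n)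
    dsimp only at this ⊢
    linarith [ha n]
  refine ⟨_, ((tendsto_atTop_ciSup hmono hbdd).add hd).congr fun n => ?_⟩
  ring

/-- If b < g, the terms eventually dominate w_i(g - b)/2, so boundedness would force the weights to
be summable. -/
theorem le_of_weighted_sum_bounded {a w : ℕ → ℝ} {b g K : ℝ} (ha : Tendsto a atTop (𝓝 b))
    (hw : ∀ i, 0 < w i) (hsum : ¬ Summable w)
    (h : ∀ n, ∑ i ∈ Finset.range n, w i * (g - a i) ≤ K) : g ≤ b := by
  by_contra! hlt
  obtain ⟨N, hN⟩ := eventually_atTop.1 (ha.eventually (gt_mem_nhds (show b < (g + b) / 2 by linarith)))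
  set δ := (g - b) / 2 with hδ
  have hδ0 : 0 < δ := by linarith
  have hge : ∀ i, δ * w (i + N) ≤ w (i + N) * (g - a (i + N)) := fun i => by
    have := hN (i + N) (by omega)
    rw [mul_comm]
    exact mul_le_mul_of_nonneg_left (by linarith) (hw _).le
  have hs : Summable fun i => w (i + N) * (g - a (i + N)) := by
    refine summable_of_sum_range_le (c := K - ∑ i ∈ Finset.range N, w i * (g - a i))
      (fun i => (mul_pos hδ0 (hw _)).le.trans (hge i)) fun n => ?_
    have := h (N + n)
    rw [Finset.sum_range_add] at this
    simp only [add_comm N] at this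
    linarith
  have hs' : Summable fun i => δ * w (i + N) :=
    Summable.of_nonneg_of_le (fun i => (mul_pos hδ0 (hw _)).le) hge hs
  exact hsum ((summable_nat_add_iff N).1 ((summable_mul_left_iff hδ0.ne').1 hs'))

/-- Square summability sends the weights to 0, so the factors 1/(1 - w_i) are bounded. -/
theorem summable_sq_div_one_sub {w : ℕ → ℝ} (hw : ∀ i, w i ∈ Set.Ioo (0 : ℝ) 1)
    (hsq : Summable fun i => w i ^ 2) : Summable fun i => w i ^ 2 / (1 - w i) := by
  have hw0 : Tendsto w atTop (𝓝 0) := by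
    have := hsq.tendsto_atTop_zero.sqrt
    simp only [Real.sqrt_zero] at this
    exact this.congr fun i => Real.sqrt_sq (hw i).1.le
  have h1 : Tendsto (fun i => (1 - w i)⁻¹) atTop (𝓝 (1 - 0)⁻¹) :=
    (tendsto_const_nhds.sub hw0).inv₀ (by norm_num)
  obtain ⟨K, hK⟩ := h1.bddAbove_range
  refine Summable.of_nonneg_of_le
    (fun i => div_nonneg (sq_nonneg _) (by linarith [(hw i).2])) (fun i => ?_) (hsq.mul_right K)
  rw [div_eq_mul_inv]
  exact mul_le_mul_of_nonneg_left (hK (Set.mem_range_self i)) (sq_nonneg _)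

theorem pr_past {Ω : Type*} (k : S2 → S2 → ℝ≥0) (w : ℕ → ℝ) (Ψ₀ : Measure S2) (s₀ : S2)
    (Y : ℕ → Ω → S2) (n : ℕ) (ω : Ω) :
    pr k w Ψ₀ (past s₀ Y n ω) n = pr k w Ψ₀ (fun i => Y i ω) n :=
  pr_truncSeq k w Ψ₀ s₀ _ n

theorem pr_succ (k : S2 → S2 → ℝ≥0) (w : ℕ → ℝ) (Ψ₀ : Measure S2) (y : ℕ → S2) (n : ℕ) :
    pr k w Ψ₀ y (n + 1) = prStep k (w n) (y n) (pr k w Ψ₀ y n) := rfl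

theorem measurable_integral_ratio_posterior_pr {k : S2 → S2 → ℝ≥0}
    (hk : Measurable (Function.uncurry k)) (w : ℕ → ℝ) (Ψ₀ ν : Measure S2) [SFinite Ψ₀]
    [SFinite ν] (n : ℕ) :
    Measurable (fun q : (ℕ → S2) × S2 =>
      ∫ s, ratio k (prPosterior k (pr k w Ψ₀ q.1 n) q.2) (pr k w Ψ₀ q.1 n) s ∂ν) := by
  refine StronglyMeasurable.measurable (StronglyMeasurable.integral_prod_right
    (f := fun (q : (ℕ → S2) × S2) s =>
      ratio k (prPosterior k (pr k w Ψ₀ q.1 n) q.2) (pr k w Ψ₀ q.1 n) s) ?_)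
  refine Measurable.stronglyMeasurable (Measurable.ennreal_toReal ?_)
  exact (measurable_mixture_posterior_pr hk w Ψ₀ n).div
    ((measurable_mixture_pr hk w Ψ₀ n).comp
      (f := fun q : ((ℕ → S2) × S2) × S2 => (q.1.1, q.2)) (by fun_prop))

/-! ### Almost sure convergence of the expected log likelihood. -/

namespace RegularKernel

variable {k : S2 → S2 → ℝ≥0} {X : Set S2} {ν : Measure S2} {B : ℝ≥0}
  {Ω : Type*} [MeasurableSpace Ω] {Pr : Measure Ω} {Y : ℕ → Ω → S2} {Ψ₀ : Measure S2}
  {w : ℕ → ℝ}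

theorem ae_forall_mixture_pos [SFinite ν] (H : RegularKernel k X ν B) (hΨ₀ : IsMixing X Ψ₀)
    (hY : ∀ i, Measurable (Y i)) (hlaw : ∀ i, Pr.map (Y i) = ν) :
    ∀ᵐ ω ∂Pr, ∀ i, 0 < mixture k Ψ₀ (Y i ω) :=
  ae_all_iff.2 fun i => ae_of_ae_map (hY i).aemeasurable (by
    rw [hlaw i]; exact H.ae_mixture_pos hΨ₀)

variable [IsProbabilityMeasure Pr] [IsProbabilityMeasure ν]

/-- The expected log likelihood of the predictive recursion estimates converges. -/
theorem ae_exists_tendsto_gain_pr (H : RegularKernel k X ν B) (hΨ₀ : IsMixing X Ψ₀)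
    (hY : ∀ i, Measurable (Y i)) (hind : iIndepFun Y Pr) (hlaw : ∀ i, Pr.map (Y i) = ν)
    (hw : ∀ i, w i ∈ Set.Ioo (0 : ℝ) 1) (hsq : Summable fun i => w i ^ 2) :
    ∀ᵐ ω ∂Pr, ∃ b, Tendsto (fun n => gain k ν (pr k w Ψ₀ (fun i => Y i ω) n) Ψ₀) atTop (𝓝 b) := by
  have := hΨ₀.isProbabilityMeasure
  have hgood := H.ae_forall_mixture_pos hΨ₀ hY hlaw
  obtain ⟨ω₀, -⟩ := hgood.exists
  -- Any point serves as padding: the n-th estimate never reads it.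
  let s₀ : S2 := Y 0 ω₀
  let G : ℕ → (ℕ → S2) → S2 → ℝ := fun n p y =>
    ∫ s, ratio k (prPosterior k (pr k w Ψ₀ p n) y) (pr k w Ψ₀ p n) s ∂ν
  have hG : ∀ n, Measurable (Function.uncurry (G n)) :=
    measurable_integral_ratio_posterior_pr H.measurable w Ψ₀ ν
  obtain ⟨C, hCB⟩ : ∃ C : ℝ≥0, (C : ℝ) = (B + 1) ^ 2 := ⟨(B + 1) ^ 2, by push_cast; rfl⟩
  have hC : ∀ n, ∀ᵐ ω ∂Pr, ∫⁻ y, ENNReal.ofReal (G n (past s₀ Y n ω) y ^ 2) ∂ν ≤ C := fun n => by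
    filter_upwards [hgood] with ω hω
    have hm := H.isMixing_pr hΨ₀ hw hω n
    simp only [G, pr_past]
    calc _ ≤ ∫⁻ _, C ∂ν := by
          refine lintegral_mono_ae ?_
          filter_upwards [H.ae_mixture_pos hm] with y hy
          rw [ENNReal.ofReal_le_iff_le_toReal ENNReal.coe_ne_top, ENNReal.coe_toReal, hCB]
          exact pow_le_pow_left₀ (integral_nonneg fun s => ratio_nonneg s)
            (H.integral_ratio_le (H.isMixing_posterior hm hy) hm) 2
      _ = _ := by simp
  filter_upwards [hgood, ae_exists_tendsto_sum_innov s₀ hY hind hlaw hG hC hsq] with ω hω hconv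
  obtain ⟨l, hl⟩ := hconv
  set y : ℕ → S2 := fun i => Y i ω with hy
  have hm := H.isMixing_pr hΨ₀ hw hω
  have hsum := ((summable_sq_div_one_sub hw hsq).mul_right ((B : ℝ) + 1)).hasSum.tendsto_sum_nat
  set I : ℕ → ℝ := fun n => innov ν (G n) (past s₀ Y n ω) (Y n ω) with hI
  have hd : Tendsto (fun n => ∑ i ∈ Finset.range n,
      (w i * I i - w i ^ 2 / (1 - w i) * ((B : ℝ) + 1))) atTop
      (𝓝 (l - ∑' i, w i ^ 2 / (1 - w i) * ((B : ℝ) + 1))) := by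
    simp only [Finset.sum_sub_distrib]
    exact hl.sub hsum
  have hb : ∀ n, gain k ν (pr k w Ψ₀ y n) Ψ₀ ≤ 2 * B + 1 := fun n =>
    (le_abs_self _).trans (H.abs_gain_le (hm n) hΨ₀)
  refine exists_tendsto_of_le_increment hb hd fun n => ?_
  have h1 := H.le_gain_prStep (ν := ν) (hm n) (hw n) (mixture_pr_pos k hw Ψ₀ y (hω n) n)
  have h2 := H.gain_add_gain (ν := ν) (hm (n + 1)) (hm n) hΨ₀
  have h3 := H.one_le_integral_posterior (ν := ν) (hm n)
  -- The innovation subtracts the conditional mean, which is at least 1 by `h3`, so it is at most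
  -- the actual drift.
  have h4 : w n * I n ≤
      w n * (∫ s, ratio k (prPosterior k (pr k w Ψ₀ y n) (y n)) (pr k w Ψ₀ y n) s ∂ν - 1) := by
    refine mul_le_mul_of_nonneg_left ?_ (hw n).1.le
    simp only [hI, innov, G, pr_past]
    linarith
  rw [pr_succ] at h2 ⊢
  linarith

/-- The weighted second moments of the likelihood are summable. -/
theorem ae_summable_likelihood_sq (H : RegularKernel k X ν B) (hΨ₀ : IsMixing X Ψ₀)
    {Φ : Measure S2} (hΦ : IsMixing X Φ)
    (hY : ∀ i, Measurable (Y i)) (hind : iIndepFun Y Pr) (hlaw : ∀ i, Pr.map (Y i) = ν)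
    (hw : ∀ i, w i ∈ Set.Ioo (0 : ℝ) 1) {c : ℕ → ℝ} (hc0 : ∀ i, 0 ≤ c i) (hc : Summable c) :
    ∀ᵐ ω ∂Pr, Summable fun n => c n * (∫⁻ x, ((k (Y n ω) x : ℝ≥0∞) /
      mixture k (pr k w Ψ₀ (fun i => Y i ω) n) (Y n ω)) ^ 2 ∂Φ).toReal := by
  have := hΨ₀.isProbabilityMeasure
  have := hΦ.isProbabilityMeasure
  have hgood := H.ae_forall_mixture_pos hΨ₀ hY hlaw
  obtain ⟨ω₀, -⟩ := hgood.exists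
  let s₀ : S2 := Y 0 ω₀
  let F : ℕ → (ℕ → S2) → S2 → ℝ≥0∞ := fun n p y =>
    ∫⁻ x, ((k y x : ℝ≥0∞) / mixture k (pr k w Ψ₀ p n) y) ^ 2 ∂Φ
  have hF : ∀ n, Measurable (Function.uncurry (F n)) := fun n => by
    refine Measurable.lintegral_prod_right' (f := fun r : ((ℕ → S2) × S2) × S2 =>
      ((k r.1.2 r.2 : ℝ≥0∞) / mixture k (pr k w Ψ₀ r.1.1 n) r.1.2) ^ 2) ?_
    have h1 : Measurable (fun r : ((ℕ → S2) × S2) × S2 => k r.1.2 r.2) :=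
      H.measurable.comp (f := fun r : ((ℕ → S2) × S2) × S2 => (r.1.2, r.2)) (by fun_prop)
    exact (h1.coe_nnreal_ennreal.div
      ((measurable_mixture_pr H.measurable w Ψ₀ n).comp measurable_fst)).pow_const 2
  have hFY : ∀ n, Measurable fun ω => F n (past s₀ Y n ω) (Y n ω) := fun n =>
    (hF n).comp ((measurable_past s₀ hY n).prodMk (hY n))
  have hE : ∀ n, ∫⁻ ω, F n (past s₀ Y n ω) (Y n ω) ∂Pr ≤ B := fun n => by
    rw [lintegral_past s₀ hY hind hlaw n (hF n)]
    calc _ ≤ ∫⁻ _, B ∂Pr := by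
          refine lintegral_mono_ae ?_
          filter_upwards [hgood] with ω hω
          simp only [F, pr_past]
          exact H.lintegral_likelihood_sq_le hΦ (H.isMixing_pr hΨ₀ hw hω n)
      _ = B := by simp
  -- Each term has mean at most c_n B, so the total has finite expectation and is almost surely
  -- finite.
  have htot : ∫⁻ ω, ∑' n, ENNReal.ofReal (c n) * F n (past s₀ Y n ω) (Y n ω) ∂Pr ≠ ∞ := by
    rw [lintegral_tsum fun n => ((hFY n).const_mul _).aemeasurable]
    refine ne_top_of_le_ne_top (ENNReal.mul_ne_top hc.tsum_ofReal_ne_top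
      (ENNReal.coe_ne_top (r := B))) ?_
    rw [← ENNReal.tsum_mul_right]
    refine ENNReal.tsum_le_tsum fun n => ?_
    rw [lintegral_const_mul _ (hFY n)]
    gcongr
    exact hE n
  filter_upwards [ae_lt_top (Measurable.tsum fun n => (hFY n).const_mul _) htot]
    with ω hω
  have hs := ENNReal.summable_toReal hω.ne
  refine hs.congr fun n => ?_
  rw [ENNReal.toReal_mul, ENNReal.toReal_ofReal (hc0 n)]
  simp only [F, pr_past]

/-- The limit of the expected log likelihood is at least that of any mixing distribution with a
bounded density with respect to the initial guess. -/
theorem ae_le_of_tendsto_gain_pr (H : RegularKernel k X ν B) (hΨ₀ : IsMixing X Ψ₀)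
    {Φ : Measure S2} (hΦ : IsMixing X Φ) {M : ℝ≥0} (hM : Φ ≤ M • Ψ₀)
    (hY : ∀ i, Measurable (Y i)) (hind : iIndepFun Y Pr) (hlaw : ∀ i, Pr.map (Y i) = ν)
    (hw : ∀ i, w i ∈ Set.Ioo (0 : ℝ) 1) (hwsum : ¬ Summable w)
    (hsq : Summable fun i => w i ^ 2) :
    ∀ᵐ ω ∂Pr, ∀ b, Tendsto (fun n => gain k ν (pr k w Ψ₀ (fun i => Y i ω) n) Ψ₀) atTop (𝓝 b) →
      gain k ν Φ Ψ₀ ≤ b := by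
  have := hΨ₀.isProbabilityMeasure
  have := hΦ.isProbabilityMeasure
  have hgood := H.ae_forall_mixture_pos hΨ₀ hY hlaw
  obtain ⟨ω₀, -⟩ := hgood.exists
  let s₀ : S2 := Y 0 ω₀
  let G : ℕ → (ℕ → S2) → S2 → ℝ := fun n p y => ratio k Φ (pr k w Ψ₀ p n) y
  have hG : ∀ n, Measurable (Function.uncurry (G n)) := fun n =>
    (((measurable_mixture H.measurable Φ).comp measurable_snd).div
      (measurable_mixture_pr H.measurable w Ψ₀ n)).ennreal_toReal
  have hC : ∀ n, ∀ᵐ ω ∂Pr, ∫⁻ y, ENNReal.ofReal (G n (past s₀ Y n ω) y ^ 2) ∂ν ≤ B := fun n => by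
    filter_upwards [hgood] with ω hω
    simp only [G, pr_past]
    exact H.lintegral_ratio_sq_le hΦ (H.isMixing_pr hΨ₀ hw hω n)
  have hc := summable_sq_div_one_sub hw hsq
  have hc0 : ∀ i, 0 ≤ w i ^ 2 / (1 - w i) := fun i =>
    div_nonneg (sq_nonneg _) (by linarith [(hw i).2])
  filter_upwards [hgood, ae_exists_tendsto_sum_innov s₀ hY hind hlaw hG hC hsq,
    H.ae_summable_likelihood_sq hΨ₀ hΦ hY hind hlaw hw hc0 hc] with ω hω hconv hV b hb
  obtain ⟨l, hl⟩ := hconv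
  set y : ℕ → S2 := fun i => Y i ω with hy
  have hm := H.isMixing_pr hΨ₀ hw hω
  set V : ℕ → ℝ := fun n => (∫⁻ x, ((k (y n) x : ℝ≥0∞) /
      mixture k (pr k w Ψ₀ y n) (y n)) ^ 2 ∂Φ).toReal
  set I : ℕ → ℝ := fun n => innov ν (G n) (past s₀ Y n ω) (Y n ω)
  obtain ⟨D, hD⟩ := hl.bddBelow_range
  have hV' : Summable fun n => w n ^ 2 / (1 - w n) * (V n + 1) := by
    simp only [mul_add, mul_one]
    exact hV.add hc
  refine le_of_weighted_sum_bounded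
    (K := M - D + ∑' n, w n ^ 2 / (1 - w n) * (V n + 1)) hb (fun i => (hw i).1) hwsum fun n => ?_
  -- The gap in gain is the gain of Φ over Ψ_n, at most the conditional mean of the ratio minus 1;
  -- the innovation replaces that mean by the observed ratio, which drives the log density.
  have hstep : ∀ n, w n * (gain k ν Φ Ψ₀ - gain k ν (pr k w Ψ₀ y n) Ψ₀) ≤
      logDens k w Ψ₀ Φ y (n + 1) - logDens k w Ψ₀ Φ y n - w n * I n +
        w n ^ 2 / (1 - w n) * (V n + 1) := fun n => by
    have h1 := (H.logDens_succ hΦ hw hω n).2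
    have h2 := H.gain_add_gain (ν := ν) hΦ (hm n) hΨ₀
    have h3 := H.gain_le_integral_ratio_sub_one (ν := ν) hΦ (hm n)
    rw [integral_sub (H.integrable_ratio hΦ (hm n)) (integrable_const 1)] at h3
    simp only [integral_const, probReal_univ, smul_eq_mul, one_mul] at h3
    have h4 : w n * (gain k ν Φ Ψ₀ - gain k ν (pr k w Ψ₀ y n) Ψ₀) ≤
        w n * (ratio k Φ (pr k w Ψ₀ y n) (y n) - 1 - I n) := by
      refine mul_le_mul_of_nonneg_left ?_ (hw n).1.le
      simp only [I, innov, G, pr_past]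
      linarith
    have h5 : w n * (ratio k Φ (pr k w Ψ₀ y n) (y n) - 1 - I n) =
      w n * (ratio k Φ (pr k w Ψ₀ y n) (y n) - 1) - w n * I n := by ring
    linarith
  have hL0 : logDens k w Ψ₀ Φ y 0 = 0 := by simp [logDens, prDens]
  calc ∑ i ∈ Finset.range n, w i * (gain k ν Φ Ψ₀ - gain k ν (pr k w Ψ₀ y i) Ψ₀)
      ≤ ∑ i ∈ Finset.range n, (logDens k w Ψ₀ Φ y (i + 1) - logDens k w Ψ₀ Φ y i - w i * I i +
        w i ^ 2 / (1 - w i) * (V i + 1)) := Finset.sum_le_sum fun i _ => hstep i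
    _ = logDens k w Ψ₀ Φ y n - ∑ i ∈ Finset.range n, w i * I i +
        ∑ i ∈ Finset.range n, w i ^ 2 / (1 - w i) * (V i + 1) := by
        rw [Finset.sum_add_distrib, Finset.sum_sub_distrib, Finset.sum_range_sub, hL0, sub_zero]
    _ ≤ _ := by
        have h1 := H.logDens_le hΨ₀ hΦ hM hw hω n
        have h2 := hD (Set.mem_range_self n)
        have h3 := hV'.sum_le_tsum (Finset.range n) fun i _ =>
          mul_nonneg (hc0 i) (add_nonneg ENNReal.toReal_nonneg zero_le_one)
        linarith

/-- The expected log likelihood of the predictive recursion estimates converges to its maximum. -/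
theorem ae_tendsto_gain_pr (H : RegularKernel k X ν B) (hΨ₀ : IsMixing X Ψ₀)
    (hX : Ψ₀.support = X) {Ψ : Measure S2} (hΨ : IsMixing X Ψ)
    (hmax : ∀ Φ, IsMixing X Φ → gain k ν Φ Ψ₀ ≤ gain k ν Ψ Ψ₀)
    (hY : ∀ i, Measurable (Y i)) (hind : iIndepFun Y Pr) (hlaw : ∀ i, Pr.map (Y i) = ν)
    (hw : ∀ i, w i ∈ Set.Ioo (0 : ℝ) 1) (hwsum : ¬ Summable w)
    (hsq : Summable fun i => w i ^ 2) :
    ∀ᵐ ω ∂Pr, Tendsto (fun n => gain k ν (pr k w Ψ₀ (fun i => Y i ω) n) Ψ₀) atTop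
      (𝓝 (gain k ν Ψ Ψ₀)) := by
  have := hΨ₀.isProbabilityMeasure
  have := hΨ.isProbabilityMeasure
  let r : ℕ → ℝ := fun n => 1 / ((n : ℝ) + 1)
  have hr0 : ∀ n, 0 < r n := fun n => Nat.one_div_pos_of_nat
  have hr : Tendsto r atTop (𝓝 0) := tendsto_one_div_add_atTop_nhds_zero_nat
  have hs : ∀ j, IsMixing X (smoothing Ψ₀ Ψ (r j)) := fun j =>
    isMixing_smoothing hΨ₀ hX hΨ (hr0 j)
  have hlim : Tendsto (fun j => gain k ν (smoothing Ψ₀ Ψ (r j)) Ψ₀) atTop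
      (𝓝 (gain k ν Ψ Ψ₀)) :=
    H.tendsto_gain hs hΨ hΨ₀ (H.tendsto_mixture_smoothing hΨ₀ hX hΨ hr0 hr)
  -- Each approximant has its own null set, so only countably many radii are used.
  have hle : ∀ᵐ ω ∂Pr, ∀ j, ∀ b,
      Tendsto (fun n => gain k ν (pr k w Ψ₀ (fun i => Y i ω) n) Ψ₀) atTop (𝓝 b) →
        gain k ν (smoothing Ψ₀ Ψ (r j)) Ψ₀ ≤ b := ae_all_iff.2 fun j => by
    obtain ⟨M, hM⟩ := exists_inv_measure_ball_le Ψ₀ (hr0 j)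
    exact H.ae_le_of_tendsto_gain_pr hΨ₀ (hs j)
      (smoothing_le (by rw [hX]; exact hΨ.ae_mem) hM) hY hind hlaw hw hwsum hsq
  filter_upwards [H.ae_forall_mixture_pos hΨ₀ hY hlaw,
    H.ae_exists_tendsto_gain_pr hΨ₀ hY hind hlaw hw hsq, hle] with ω hω hconv hω'
  obtain ⟨b, hb⟩ := hconv
  have h1 : gain k ν Ψ Ψ₀ ≤ b := le_of_tendsto' hlim fun j => hω' j b hb
  have h2 : b ≤ gain k ν Ψ Ψ₀ := le_of_tendsto' hb fun n => hmax _ (H.isMixing_pr hΨ₀ hw hω n)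
  rwa [le_antisymm h1 h2]

end RegularKernel

/-! ### Weak compactness, maximisers and strict concavity. -/

theorem isMixing_coe {X : Set S2} {Ψ : ProbabilityMeasure S2} :
    Ψ ∈ mixing X ↔ IsMixing X (Ψ : Measure S2) :=
  ⟨fun h => ⟨inferInstance, h⟩, fun h => h.null⟩

theorem isClosed_mixing {X : Set S2} (hX : IsClosed X) : IsClosed (mixing X) := by
  refine IsSeqClosed.isClosed fun P Ψ hP hlim => ?_
  have h := ProbabilityMeasure.le_liminf_measure_open_of_tendsto hlim hX.isOpen_compl
  have h0 : ∀ n, (P n : Measure S2) Xᶜ = 0 := hP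
  simp only [h0, liminf_const] at h
  exact le_antisymm h zero_le

namespace RegularKernel

variable {k : S2 → S2 → ℝ≥0} {X : Set S2} {ν : Measure S2} {B : ℝ≥0}

theorem tendsto_mixture (H : RegularKernel k X ν B) {P : ℕ → ProbabilityMeasure S2}
    {Φ : ProbabilityMeasure S2} (hP : ∀ n, P n ∈ mixing X) (hΦ : Φ ∈ mixing X)
    (hlim : Tendsto P atTop (𝓝 Φ)) (y : S2) :
    Tendsto (fun n => mixture k (P n : Measure S2) y) atTop (𝓝 (mixture k (Φ : Measure S2) y)) := by
  -- The kernel is continuous in the parameter only on X. Tietze extends it to the sphere, and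
  -- taking positive parts makes it a nonnegative test function without changing it on X.
  obtain ⟨g, hg⟩ := ContinuousMap.exists_restrict_eq H.isClosed
    (⟨fun x : X => (k y x : ℝ), by
      have := (H.continuousOn y).domRestrict
      exact NNReal.continuous_coe.comp this⟩ : C(X, ℝ))
  have hgX : ∀ x ∈ X, (g x).toNNReal = k y x := fun x hx => by
    have : g x = k y x := congrArg (fun f : C(X, ℝ) => f ⟨x, hx⟩) hg
    rw [this, Real.toNNReal_coe]
  let φ : BoundedContinuousFunction S2 ℝ≥0 := BoundedContinuousFunction.mkOfCompact
    ⟨fun x => (g x).toNNReal, by fun_prop⟩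
  have hφ : ∀ Ψ : ProbabilityMeasure S2, Ψ ∈ mixing X →
      ∫⁻ x, (φ x : ℝ≥0∞) ∂(Ψ : Measure S2) = mixture k (Ψ : Measure S2) y := fun Ψ hΨ => by
    refine lintegral_congr_ae ?_
    filter_upwards [(isMixing_coe.1 hΨ).ae_mem] with x hx
    exact congrArg _ (hgX x hx)
  have := ProbabilityMeasure.tendsto_iff_forall_lintegral_tendsto.1 hlim φ
  simpa only [hφ _ hΦ, hφ _ (hP _)] using this

theorem tendsto_gain_of_tendsto [IsFiniteMeasure ν] (H : RegularKernel k X ν B) {Ψ₀ : Measure S2}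
    (hΨ₀ : IsMixing X Ψ₀) {P : ℕ → ProbabilityMeasure S2}
    {Φ : ProbabilityMeasure S2} (hP : ∀ n, P n ∈ mixing X) (hΦ : Φ ∈ mixing X)
    (hlim : Tendsto P atTop (𝓝 Φ)) :
    Tendsto (fun n => gain k ν (P n : Measure S2) Ψ₀) atTop
      (𝓝 (gain k ν (Φ : Measure S2) Ψ₀)) :=
  H.tendsto_gain (fun n => isMixing_coe.1 (hP n)) (isMixing_coe.1 hΦ) hΨ₀
    (H.tendsto_mixture hP hΦ hlim)

theorem exists_forall_gain_le [IsFiniteMeasure ν] (H : RegularKernel k X ν B) {Ψ₀ : Measure S2}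
    (hΨ₀ : IsMixing X Ψ₀) : ∃ Ψ : ProbabilityMeasure S2, Ψ ∈ mixing X ∧
      ∀ Φ, IsMixing X Φ → gain k ν Φ Ψ₀ ≤ gain k ν (Ψ : Measure S2) Ψ₀ := by
  have hc : IsCompact (mixing X) := (isClosed_mixing H.isClosed).isCompact
  have hne : (mixing X).Nonempty := ⟨⟨Ψ₀, hΨ₀.isProbabilityMeasure⟩, hΨ₀.null⟩
  have hcont : ContinuousOn (fun Ψ : ProbabilityMeasure S2 => gain k ν (Ψ : Measure S2) Ψ₀)
      (mixing X) := by
    rw [continuousOn_iff_continuous_domRestrict]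
    refine continuous_iff_seqContinuous.2 fun P Φ hlim => ?_
    exact H.tendsto_gain_of_tendsto hΨ₀ (fun n => (P n).2) Φ.2
      ((continuous_subtype_val.tendsto Φ).comp hlim)
  obtain ⟨Ψ, hΨ, hmax⟩ := hc.exists_isMaxOn hne hcont
  exact ⟨Ψ, hΨ, fun Φ hΦ => hmax (a := ⟨Φ, hΦ.isProbabilityMeasure⟩) hΦ.null⟩

/-- Mixing distributions whose expected log likelihoods approach that of the unique maximizer
converge to it. -/
theorem tendsto_of_tendsto_gain [IsFiniteMeasure ν] (H : RegularKernel k X ν B) {Ψ₀ : Measure S2}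
    (hΨ₀ : IsMixing X Ψ₀) {P : ℕ → ProbabilityMeasure S2}
    {Ψ : ProbabilityMeasure S2} (hP : ∀ n, P n ∈ mixing X)
    (huniq : ∀ Φ ∈ mixing X,
      gain k ν (Φ : Measure S2) Ψ₀ = gain k ν (Ψ : Measure S2) Ψ₀ → Φ = Ψ)
    (hlim : Tendsto (fun n => gain k ν (P n : Measure S2) Ψ₀) atTop
      (𝓝 (gain k ν (Ψ : Measure S2) Ψ₀))) : Tendsto P atTop (𝓝 Ψ) := by
  refine (isClosed_mixing H.isClosed).isCompact.tendsto_nhds_of_unique_mapClusterPt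
    (Eventually.of_forall hP) fun Φ hΦ hcl => huniq Φ hΦ ?_
  obtain ⟨ψ, hψ, hsub⟩ := hcl.tendsto_subseq
  exact tendsto_nhds_unique
    (H.tendsto_gain_of_tendsto hΨ₀ (fun n => hP (ψ n)) hΦ hsub) (hlim.comp hψ.tendsto_atTop)

end RegularKernel

theorem eq_of_log_midpoint_le {a b : ℝ} (ha : 0 < a) (hb : 0 < b)
    (h : Real.log ((a + b) / 2) = (Real.log a + Real.log b) / 2) : a = b := by
  have h1 : Real.log (((a + b) / 2) ^ 2) = Real.log (a * b) := by
    rw [Real.log_pow, Real.log_mul ha.ne' hb.ne', h]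
    push_cast
    ring
  have h2 := Real.log_injOn_pos (Set.mem_Ioi.2 (by positivity)) (Set.mem_Ioi.2 (by positivity)) h1
  nlinarith [sq_nonneg (a - b)]

theorem log_add_log_div_two_le {a b : ℝ} (ha : 0 < a) (hb : 0 < b) :
    (Real.log a + Real.log b) / 2 ≤ Real.log ((a + b) / 2) := by
  have h1 : Real.log (a * b) ≤ Real.log (((a + b) / 2) ^ 2) :=
    Real.log_le_log (by positivity) (by nlinarith [sq_nonneg (a - b)])
  rw [Real.log_pow, Real.log_mul ha.ne' hb.ne'] at h1
  push_cast at h1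
  linarith

namespace RegularKernel

variable {k : S2 → S2 → ℝ≥0} {X : Set S2} {ν : Measure S2} {B : ℝ≥0}

/-- Maximizers of the expected log likelihood have the same mixture density. -/
theorem mixture_ae_eq_of_gain_eq [IsFiniteMeasure ν] (H : RegularKernel k X ν B)
    {Ψ₀ Ψ₁ Ψ₂ : Measure S2} (hΨ₀ : IsMixing X Ψ₀) (h₁ : IsMixing X Ψ₁) (h₂ : IsMixing X Ψ₂)
    (hmax : ∀ Φ, IsMixing X Φ → gain k ν Φ Ψ₀ ≤ gain k ν Ψ₁ Ψ₀)
    (heq : gain k ν Ψ₂ Ψ₀ = gain k ν Ψ₁ Ψ₀) : mixture k Ψ₁ =ᵐ[ν] mixture k Ψ₂ := by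
  have := h₁.isProbabilityMeasure
  have := h₂.isProbabilityMeasure
  -- Maximality against the midpoint forces the concavity defect of log, which is nonnegative, to
  -- have integral 0; it then vanishes almost everywhere, which is the equality case.
  let Φ : Measure S2 := (2⁻¹ : ℝ≥0∞) • Ψ₁ + (2⁻¹ : ℝ≥0∞) • Ψ₂
  have hΦ : IsMixing X Φ := by
    refine ⟨⟨?_⟩, ?_⟩
    · simp [Φ, ENNReal.inv_two_add_inv_two]
    · simp [Φ, h₁.null, h₂.null]
  have hr : ∀ᵐ y ∂ν, ratio k Φ Ψ₀ y = (ratio k Ψ₁ Ψ₀ y + ratio k Ψ₂ Ψ₀ y) / 2 := by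
    filter_upwards with y
    have hmix : mixture k Φ y = 2⁻¹ * mixture k Ψ₁ y + 2⁻¹ * mixture k Ψ₂ y := by
      simp only [mixture, Φ, lintegral_add_measure, lintegral_smul_measure, smul_eq_mul]
    have hne : ∀ c : ℝ≥0∞, c ≠ ∞ → (2⁻¹ : ℝ≥0∞) * c ≠ ∞ := fun c hc =>
      ENNReal.mul_ne_top (by simp) hc
    rw [ratio, ratio, ratio, ENNReal.toReal_div, ENNReal.toReal_div, ENNReal.toReal_div, hmix,
      ENNReal.toReal_add (hne _ (H.mixture_ne_top h₁ y)) (hne _ (H.mixture_ne_top h₂ y)),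
      ENNReal.toReal_mul, ENNReal.toReal_mul, ENNReal.toReal_inv, ENNReal.toReal_ofNat]
    ring
  have i0 := H.integrable_log_ratio (ν := ν) hΦ hΨ₀
  have i1 := H.integrable_log_ratio (ν := ν) h₁ hΨ₀
  have i2 := H.integrable_log_ratio (ν := ν) h₂ hΨ₀
  have i12 : Integrable (fun y => (Real.log (ratio k Ψ₁ Ψ₀ y) + Real.log (ratio k Ψ₂ Ψ₀ y)) / 2) ν :=
    (i1.add i2).div_const 2
  have hnn : 0 ≤ᵐ[ν] fun y => Real.log (ratio k Φ Ψ₀ y) -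
      (Real.log (ratio k Ψ₁ Ψ₀ y) + Real.log (ratio k Ψ₂ Ψ₀ y)) / 2 := by
    filter_upwards [hr, H.ae_ratio_pos h₁ hΨ₀, H.ae_ratio_pos h₂ hΨ₀] with y e p1 p2
    rw [e]
    exact sub_nonneg.2 (log_add_log_div_two_le p1 p2)
  have hint : ∫ y, (Real.log (ratio k Φ Ψ₀ y) -
      (Real.log (ratio k Ψ₁ Ψ₀ y) + Real.log (ratio k Ψ₂ Ψ₀ y)) / 2) ∂ν = 0 := by
    refine le_antisymm ?_ (integral_nonneg_of_ae hnn)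
    rw [integral_sub i0 i12, integral_div, integral_add i1 i2]
    have h := hmax Φ hΦ
    simp only [gain] at h heq
    linarith
  have hz := (integral_eq_zero_iff_of_nonneg_ae hnn (i0.sub i12)).1 hint
  filter_upwards [hr, H.ae_ratio_pos h₁ hΨ₀, H.ae_ratio_pos h₂ hΨ₀, hz, H.ae_mixture_pos hΨ₀]
    with y e p1 p2 hy p0
  rw [e, Pi.zero_apply, sub_eq_zero] at hy
  have h3 := eq_of_log_midpoint_le p1 p2 hy
  rw [ratio, ratio, ENNReal.toReal_div, ENNReal.toReal_div, div_left_inj'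
    (ENNReal.toReal_pos p0.ne' (H.mixture_ne_top hΨ₀ y)).ne'] at h3
  exact (ENNReal.toReal_eq_toReal_iff' (H.mixture_ne_top h₁ y) (H.mixture_ne_top h₂ y)).1 h3

end RegularKernel

/-! ### Kullback-Leibler divergence and L¹ distance. -/

section KullbackLeibler

instance : IsFiniteMeasure surf := by unfold surf; infer_instance

theorem isProbabilityMeasure_law {f : S2 → ℝ≥0∞} (hf : ∫⁻ y, f y ∂surf = 1) :
    IsProbabilityMeasure (law f) :=
  ⟨by rw [law, withDensity_apply _ MeasurableSet.univ, setLIntegral_univ, hf]⟩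

variable {f g : S2 → ℝ≥0∞}

theorem mul_div_ae_eq (hf : Measurable f) (hg' : ∀ y, g y ≠ ∞)
    (hpos : ∀ᵐ y ∂(law f), 0 < g y) : (fun y => g y * (f y / g y)) =ᵐ[surf] f := by
  filter_upwards [(ae_withDensity_iff hf).1 hpos] with y hy
  by_cases h : f y = 0
  · simp [h]
  · exact ENNReal.mul_div_cancel (hy h).ne' (hg' y)

theorem law_withDensity_div (hf : Measurable f) (hg : Measurable g) (hg' : ∀ y, g y ≠ ∞)
    (hpos : ∀ᵐ y ∂(law f), 0 < g y) : (law g).withDensity (fun y => f y / g y) = law f := by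
  have h := withDensity_mul surf hg (hf.div hg)
  rw [law]
  refine h.symm.trans ?_
  exact withDensity_congr_ae (mul_div_ae_eq hf hg' hpos)

theorem law_absolutelyContinuous (hf : Measurable f) (hg : Measurable g) (hg' : ∀ y, g y ≠ ∞)
    (hpos : ∀ᵐ y ∂(law f), 0 < g y) : law f ≪ law g := by
  rw [← law_withDensity_div hf hg hg' hpos]
  exact withDensity_absolutelyContinuous _ _

theorem rnDeriv_law (hf : Measurable f) (hg : Measurable g) (hg' : ∀ y, g y ≠ ∞)
    (hg1 : ∫⁻ y, g y ∂surf = 1) (hpos : ∀ᵐ y ∂(law f), 0 < g y) :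
    (law f).rnDeriv (law g) =ᵐ[law g] fun y => f y / g y := by
  have := isProbabilityMeasure_law hg1
  have h := Measure.rnDeriv_withDensity (law g) (hf.div hg)
  exact (law_withDensity_div hf hg hg' hpos) ▸ h

theorem llr_law (hf : Measurable f) (hg : Measurable g) (hg' : ∀ y, g y ≠ ∞)
    (hg1 : ∫⁻ y, g y ∂surf = 1) (hpos : ∀ᵐ y ∂(law f), 0 < g y) :
    llr (law f) (law g) =ᵐ[law f] fun y => Real.log (f y / g y).toReal := by
  filter_upwards [(law_absolutelyContinuous hf hg hg' hpos).ae_le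
    (rnDeriv_law hf hg hg' hg1 hpos)] with y hy
  rw [llr, hy]

theorem KL_eq_ofReal_integral (hf : Measurable f) (hg : Measurable g) (hg' : ∀ y, g y ≠ ∞)
    (hf1 : ∫⁻ y, f y ∂surf = 1) (hg1 : ∫⁻ y, g y ∂surf = 1) (hpos : ∀ᵐ y ∂(law f), 0 < g y)
    (hint : Integrable (fun y => Real.log (f y / g y).toReal) (law f)) :
    0 ≤ ∫ y, Real.log (f y / g y).toReal ∂(law f) ∧
      KL f g = ENNReal.ofReal (∫ y, Real.log (f y / g y).toReal ∂(law f)) := by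
  have := isProbabilityMeasure_law hf1
  have := isProbabilityMeasure_law hg1
  have hac := law_absolutelyContinuous hf hg hg' hpos
  have hllr := llr_law hf hg hg' hg1 hpos
  have hi := (integrable_congr hllr).2 hint
  have h0 := InformationTheory.integral_llr_add_sub_measure_univ_nonneg hac hi
  rw [KL, InformationTheory.klDiv_of_ac_of_integrable hac hi]
  rw [integral_congr_ae hllr] at h0 ⊢
  simpa using h0

theorem KL_eq_top (hf : Measurable f) (hg : Measurable g) (hg' : ∀ y, g y ≠ ∞)
    (hg1 : ∫⁻ y, g y ∂surf = 1) (hpos : ∀ᵐ y ∂(law f), 0 < g y)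
    (hint : ¬ Integrable (fun y => Real.log (f y / g y).toReal) (law f)) : KL f g = ∞ :=
  InformationTheory.klDiv_of_not_integrable
    fun h => hint ((integrable_congr (llr_law hf hg hg' hg1 hpos)).1 h)

/-- With s = √r, the Hellinger bound (s - 1)² ≤ `klFun r` follows from log s ≥ 1 - 1/s. Then |r - 1|
= |s - 1|(s + 1) is split by the weighted arithmetic-geometric inequality. Being affine in `klFun r`
and r, the bound integrates directly. -/
theorem abs_sub_one_le_klFun {r t : ℝ} (hr : 0 ≤ r) (ht : 0 < t) :
    |r - 1| ≤ (2 * t)⁻¹ * InformationTheory.klFun r + t * (r + 1) := by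
  set s := √r with hs
  have hs0 : 0 ≤ s := Real.sqrt_nonneg r
  have hsr : s ^ 2 = r := Real.sq_sqrt hr
  have h1 : (s - 1) ^ 2 ≤ InformationTheory.klFun r := by
    rcases hs0.eq_or_lt with h | h
    · have : r = 0 := by rw [← hsr, ← h]; norm_num
      rw [this, ← h]
      simp [InformationTheory.klFun]
    · have hlog : Real.log r = 2 * Real.log s := by rw [← hsr, Real.log_pow]; norm_num
      have hl := Real.one_sub_inv_le_log_of_pos h
      rw [InformationTheory.klFun, hlog, ← hsr]
      have h2 : s ^ 2 * (1 - s⁻¹) = s ^ 2 - s := by field_simp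
      have h3 := mul_le_mul_of_nonneg_left hl (sq_nonneg s)
      nlinarith
  have h2 : |r - 1| = |s - 1| * (s + 1) := by
    rw [← abs_of_nonneg (show 0 ≤ s + 1 by linarith), ← abs_mul, ← hsr]
    congr 1
    ring
  have h3 : |s - 1| * (s + 1) ≤ (2 * t)⁻¹ * (s - 1) ^ 2 + t * (s ^ 2 + 1) := by
    have e : (2 * t)⁻¹ * (s - 1) ^ 2 = |s - 1| ^ 2 / (2 * t) := by
      rw [sq_abs]
      field_simp
    rw [e, ← sub_le_iff_le_add, le_div_iff₀ (by positivity)]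
    nlinarith [sq_nonneg (|s - 1| - t * (s + 1)), mul_nonneg (mul_nonneg ht.le ht.le)
      (sq_nonneg (s - 1))]
  rw [h2]
  refine h3.trans ?_
  rw [hsr]
  gcongr

/-- The `L¹` distance of two densities is small if their Kullback-Leibler divergence is. -/
theorem lintegral_abs_sub_le_KL (hf : Measurable f) (hg : Measurable g) (hf' : ∀ y, f y ≠ ∞)
    (hg' : ∀ y, g y ≠ ∞) (hf1 : ∫⁻ y, f y ∂surf = 1) (hg1 : ∫⁻ y, g y ∂surf = 1)
    (hpos : ∀ᵐ y ∂(law f), 0 < g y) {t : ℝ} (ht : 0 < t) :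
    ∫⁻ y, ENNReal.ofReal |(g y).toReal - (f y).toReal| ∂surf ≤
      ENNReal.ofReal (2 * t)⁻¹ * KL f g + ENNReal.ofReal (2 * t) := by
  have := isProbabilityMeasure_law hf1
  have := isProbabilityMeasure_law hg1
  have hac := law_absolutelyContinuous hf hg hg' hpos
  set r : S2 → ℝ≥0∞ := fun y => f y / g y with hr
  have hrm : Measurable r := hf.div hg
  have hrfin : ∀ᵐ y ∂(law g), r y ≠ ∞ := by
    refine (ae_withDensity_iff hg).2 (ae_of_all _ fun y hy => ENNReal.div_ne_top (hf' y) hy)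
  have hKL : KL f g = ∫⁻ y, ENNReal.ofReal (InformationTheory.klFun (r y).toReal) ∂(law g) := by
    rw [KL, InformationTheory.klDiv_eq_lintegral_klFun_of_ac hac]
    refine lintegral_congr_ae ?_
    filter_upwards [rnDeriv_law hf hg hg' hg1 hpos] with y hy
    rw [hy]
  -- The likelihood ratio has mean 1, so the second term of the pointwise bound integrates to 2t.
  have hr1 : ∫⁻ y, r y ∂(law g) = 1 := by
    have h := (isProbabilityMeasure_law hf1).measure_univ
    rwa [← law_withDensity_div hf hg hg' hpos, withDensity_apply _ MeasurableSet.univ,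
      setLIntegral_univ] at h
  have hmeas : Measurable fun y => ENNReal.ofReal |(r y).toReal - 1| := by
    have := (hrm.ennreal_toReal.sub_const 1).abs
    exact this.ennreal_ofReal
  have hL : ∫⁻ y, ENNReal.ofReal |(g y).toReal - (f y).toReal| ∂surf =
      ∫⁻ y, ENNReal.ofReal |(r y).toReal - 1| ∂(law g) := by
    rw [law, lintegral_withDensity_eq_lintegral_mul _ hg hmeas]
    refine lintegral_congr_ae ?_
    filter_upwards [mul_div_ae_eq hf hg' hpos] with y hy
    have hy' : (g y).toReal * (r y).toReal = (f y).toReal := by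
      rw [← ENNReal.toReal_mul]
      exact congrArg _ hy
    rw [Pi.mul_apply, ← hy', ← ENNReal.ofReal_toReal (hg' y),
      ← ENNReal.ofReal_mul ENNReal.toReal_nonneg, ENNReal.toReal_ofReal ENNReal.toReal_nonneg,
      ← abs_of_nonneg (ENNReal.toReal_nonneg (a := g y)), ← abs_mul, abs_sub_comm]
    simp only [abs_of_nonneg (ENNReal.toReal_nonneg (a := g y)), mul_sub, mul_one]
  rw [hL, hKL]
  calc ∫⁻ y, ENNReal.ofReal |(r y).toReal - 1| ∂(law g)
      ≤ ∫⁻ y, (ENNReal.ofReal (2 * t)⁻¹ * ENNReal.ofReal (InformationTheory.klFun (r y).toReal) +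
          ENNReal.ofReal t * (r y + 1)) ∂(law g) := by
        refine lintegral_mono_ae ?_
        filter_upwards [hrfin] with y hy
        have hnn : 0 ≤ (r y).toReal := ENNReal.toReal_nonneg
        refine (ENNReal.ofReal_le_ofReal (abs_sub_one_le_klFun hnn ht)).trans
          (ENNReal.ofReal_add_le.trans ?_)
        rw [ENNReal.ofReal_mul (by positivity), ENNReal.ofReal_mul ht.le,
          ENNReal.ofReal_add hnn zero_le_one, ENNReal.ofReal_toReal hy, ENNReal.ofReal_one]
    _ = _ := by
        rw [lintegral_add_right _ ((hrm.add_const 1).const_mul _),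
          lintegral_const_mul' _ _ ENNReal.ofReal_ne_top,
          lintegral_const_mul' _ _ ENNReal.ofReal_ne_top, lintegral_add_left hrm, hr1]
        simp only [lintegral_const, measure_univ, mul_one]
        rw [ENNReal.ofReal_mul zero_le_two, mul_comm (ENNReal.ofReal 2), one_add_one_eq_two]
        simp

theorem tendsto_zero_of_le_mul_add {a b : ℕ → ℝ≥0∞} (hb : Tendsto b atTop (𝓝 0))
    (h : ∀ n, ∀ t : ℝ, 0 < t →
      a n ≤ ENNReal.ofReal (2 * t)⁻¹ * b n + ENNReal.ofReal (2 * t)) :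
    Tendsto a atTop (𝓝 0) := by
  rw [ENNReal.tendsto_nhds_zero]
  intro ε hε
  obtain ⟨δ, hδ0, hδ⟩ := ENNReal.lt_iff_exists_nnreal_btwn.1 hε
  have hδ0' : (0 : ℝ) < δ := by exact_mod_cast hδ0
  -- With t = δ/4 and b n ≤ δ²/4, each of the two terms is at most δ/2.
  have hpos : (0 : ℝ≥0∞) < ENNReal.ofReal (δ ^ 2 / 4) := ENNReal.ofReal_pos.2 (by positivity)
  filter_upwards [ENNReal.tendsto_nhds_zero.1 hb _ hpos] with n hn
  refine le_trans ?_ hδ.le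
  calc a n ≤ ENNReal.ofReal (2 * ((δ : ℝ) / 4))⁻¹ * b n + ENNReal.ofReal (2 * ((δ : ℝ) / 4)) :=
        h n _ (by positivity)
    _ ≤ ENNReal.ofReal (2 * ((δ : ℝ) / 4))⁻¹ * ENNReal.ofReal (δ ^ 2 / 4) +
        ENNReal.ofReal (2 * ((δ : ℝ) / 4)) := by gcongr
    _ = ENNReal.ofReal δ := by
        rw [← ENNReal.ofReal_mul (by positivity), ← ENNReal.ofReal_add (by positivity)
          (by positivity)]
        congr 1
        field_simp
        ring
    _ = δ := ENNReal.ofReal_coe_nnreal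

end KullbackLeibler

theorem lintegral_mixture_eq_one {k : S2 → S2 → ℝ≥0} (hk : Measurable (Function.uncurry k))
    {X : Set S2} (hk_dens : ∀ x ∈ X, ∫⁻ y, (k y x : ℝ≥0∞) ∂surf = 1) {Ψ : Measure S2}
    (hΨ : IsMixing X Ψ) : ∫⁻ y, mixture k Ψ y ∂surf = 1 := by
  have := hΨ.isProbabilityMeasure
  simp only [mixture]
  rw [lintegral_lintegral_swap hk.coe_nnreal_ennreal.aemeasurable]
  calc _ = ∫⁻ _, 1 ∂Ψ := by
        refine lintegral_congr_ae ?_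
        filter_upwards [hΨ.ae_mem] with x hx using hk_dens x hx
    _ = 1 := by simp

/-! ### Divergence of mixtures in terms of gain. -/

section

variable {k : S2 → S2 → ℝ≥0} {X : Set S2} {f : S2 → ℝ≥0∞} {B : ℝ≥0} {Ψ₀ : Measure S2}

/-- The Kullback-Leibler divergences from `f` of the mixture densities are either all infinite or
all finite; in the latter case they are determined by the expected log likelihood ratios. -/
theorem KL_mixture_dichotomy (hf : Measurable f) (hf' : ∀ y, f y ≠ ∞)
    (hf1 : ∫⁻ y, f y ∂surf = 1) (H : RegularKernel k X (law f) B)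
    (hk_dens : ∀ x ∈ X, ∫⁻ y, (k y x : ℝ≥0∞) ∂surf = 1) (hΨ₀ : IsMixing X Ψ₀) :
    (∀ Φ, IsMixing X Φ → KL f (mixture k Φ) = ∞) ∨
      ∃ c : ℝ, ∀ Φ, IsMixing X Φ → 0 ≤ c - gain k (law f) Φ Ψ₀ ∧
        KL f (mixture k Φ) = ENNReal.ofReal (c - gain k (law f) Φ Ψ₀) := by
  have := isProbabilityMeasure_law hf1
  have hmeas : ∀ Φ, IsMixing X Φ → Measurable (mixture k Φ) := fun Φ hΦ => by
    have := hΦ.isProbabilityMeasure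
    exact measurable_mixture H.measurable Φ
  -- The last term is always integrable, so integrability of the left side does not depend on Φ;
  -- this is the source of the dichotomy.
  have hsplit : ∀ Φ, IsMixing X Φ → (fun y => Real.log (f y / mixture k Φ y).toReal) =ᵐ[law f]
      fun y => Real.log (f y / mixture k Ψ₀ y).toReal - Real.log (ratio k Φ Ψ₀ y) := fun Φ hΦ => by
    have hfpos : ∀ᵐ y ∂(law f), f y ≠ 0 := (ae_withDensity_iff hf).2 (ae_of_all _ fun y h => h)
    filter_upwards [hfpos, H.ae_mixture_pos hΦ, H.ae_mixture_pos hΨ₀] with y h0 h1 h2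
    have p0 := (ENNReal.toReal_pos h0 (hf' y)).ne'
    have p1 := (ENNReal.toReal_pos h1.ne' (H.mixture_ne_top hΦ y)).ne'
    have p2 := (ENNReal.toReal_pos h2.ne' (H.mixture_ne_top hΨ₀ y)).ne'
    rw [ratio, ENNReal.toReal_div, ENNReal.toReal_div, ENNReal.toReal_div, Real.log_div p0 p1,
      Real.log_div p0 p2, Real.log_div p1 p2]
    ring
  by_cases hi : Integrable (fun y => Real.log (f y / mixture k Ψ₀ y).toReal) (law f)
  · refine Or.inr ⟨∫ y, Real.log (f y / mixture k Ψ₀ y).toReal ∂(law f), fun Φ hΦ => ?_⟩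
    have hl := H.integrable_log_ratio hΦ hΨ₀
    have h := KL_eq_ofReal_integral hf (hmeas Φ hΦ) (H.mixture_ne_top hΦ) hf1
      (lintegral_mixture_eq_one H.measurable hk_dens hΦ) (H.ae_mixture_pos hΦ)
      ((integrable_congr (hsplit Φ hΦ)).2 (hi.sub hl))
    rwa [integral_congr_ae (hsplit Φ hΦ), integral_sub hi hl] at h
  · refine Or.inl fun Φ hΦ => ?_
    refine KL_eq_top hf (hmeas Φ hΦ) (H.mixture_ne_top hΦ)
      (lintegral_mixture_eq_one H.measurable hk_dens hΦ) (H.ae_mixture_pos hΦ) fun h => hi ?_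
    refine (((integrable_congr (hsplit Φ hΦ)).1 h).add (H.integrable_log_ratio hΦ hΨ₀)).congr
      (ae_of_all _ fun y => ?_)
    simp only [Pi.add_apply, sub_add_cancel]

theorem infKL_eq {Ψ : ProbabilityMeasure S2} (hΨ : Ψ ∈ mixing X)
    (h : ∀ Φ, IsMixing X Φ → KL f (mixture k (Ψ : Measure S2)) ≤ KL f (mixture k Φ)) :
    infKL k X f = KL f (mixture k (Ψ : Measure S2)) :=
  le_antisymm (iInf₂_le Ψ hΨ) (le_iInf₂ fun Φ hΦ => h Φ (isMixing_coe.1 hΦ))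

theorem KL_eq_zero_of_ae_eq {g : S2 → ℝ≥0∞} (hf1 : ∫⁻ y, f y ∂surf = 1) (h : f =ᵐ[surf] g) :
    KL f g = 0 := by
  have := isProbabilityMeasure_law hf1
  rw [KL, show law g = law f from (withDensity_congr_ae h).symm]
  exact InformationTheory.klDiv_self _

theorem ae_eq_of_KL_eq_zero {g : S2 → ℝ≥0∞} (hf : Measurable f) (hg : Measurable g)
    (hf1 : ∫⁻ y, f y ∂surf = 1) (hg1 : ∫⁻ y, g y ∂surf = 1) (h : KL f g = 0) :
    f =ᵐ[surf] g := by
  have := isProbabilityMeasure_law hf1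
  have := isProbabilityMeasure_law hg1
  have he : law f = law g := InformationTheory.klDiv_eq_zero_iff.1 h
  exact (withDensity_eq_iff hf.aemeasurable hg.aemeasurable (by simp [hf1])).1 he

end

/-! ### Convergence of the estimates. -/

section

variable {Ω : Type*} [MeasurableSpace Ω] {Pr : Measure Ω} [IsProbabilityMeasure Pr]
  {k : S2 → S2 → ℝ≥0} {X : Set S2} {f : S2 → ℝ≥0∞} {B : ℝ≥0} {Ψ₀ : Measure S2}
  {Y : ℕ → Ω → S2} {w : ℕ → ℝ}

/-- When all divergences are infinite both sides are constantly ∞, so no finiteness is assumed;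
otherwise convergence of gain to its maximum is convergence of divergence to its minimum. -/
theorem ae_tendsto_KL_pr (hf : Measurable f) (hf' : ∀ y, f y ≠ ∞)
    (hf1 : ∫⁻ y, f y ∂surf = 1) (H : RegularKernel k X (law f) B)
    (hk_dens : ∀ x ∈ X, ∫⁻ y, (k y x : ℝ≥0∞) ∂surf = 1) (hΨ₀ : IsMixing X Ψ₀)
    (hX : Ψ₀.support = X)
    (hY : ∀ i, Measurable (Y i)) (hind : iIndepFun Y Pr) (hlaw : ∀ i, Pr.map (Y i) = law f)
    (hw : ∀ i, w i ∈ Set.Ioo (0 : ℝ) 1) (hwsum : ¬ Summable w)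
    (hsq : Summable fun i => w i ^ 2) :
    ∀ᵐ ω ∂Pr, Tendsto (fun n => KL f (mixture k (pr k w Ψ₀ (fun i => Y i ω) n))) atTop
      (𝓝 (infKL k X f)) := by
  have := isProbabilityMeasure_law hf1
  obtain ⟨Ψ, hΨ, hmax⟩ := H.exists_forall_gain_le hΨ₀
  have hΨ' := isMixing_coe.1 hΨ
  filter_upwards [H.ae_forall_mixture_pos hΨ₀ hY hlaw,
    H.ae_tendsto_gain_pr hΨ₀ hX hΨ' hmax hY hind hlaw hw hwsum hsq] with ω hω hlim
  have hm := H.isMixing_pr hΨ₀ hw hω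
  rcases KL_mixture_dichotomy hf hf' hf1 H hk_dens hΨ₀ with htop | ⟨c, hc⟩
  · rw [infKL_eq hΨ fun Φ hΦ => by rw [htop Φ hΦ]; exact le_top, htop _ hΨ']
    simp only [htop _ (hm _), tendsto_const_nhds]
  · have hinf : infKL k X f = KL f (mixture k (Ψ : Measure S2)) := infKL_eq hΨ fun Φ hΦ => by
      rw [(hc Φ hΦ).2, (hc _ hΨ').2]
      exact ENNReal.ofReal_le_ofReal (by linarith [hmax Φ hΦ])
    rw [hinf, (hc _ hΨ').2]
    simp only [(hc _ (hm _)).2]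
    exact ENNReal.tendsto_ofReal (tendsto_const_nhds.sub hlim)

/-- The predictive recursion estimates converge weakly to the unique minimizer of the
Kullback-Leibler divergence. -/
theorem ae_weaklyTo_pr (hf : Measurable f) (hf' : ∀ y, f y ≠ ∞)
    (hf1 : ∫⁻ y, f y ∂surf = 1) (H : RegularKernel k X (law f) B)
    (hk_dens : ∀ x ∈ X, ∫⁻ y, (k y x : ℝ≥0∞) ∂surf = 1) (hΨ₀ : IsMixing X Ψ₀)
    (hX : Ψ₀.support = X)
    (hY : ∀ i, Measurable (Y i)) (hind : iIndepFun Y Pr) (hlaw : ∀ i, Pr.map (Y i) = law f)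
    (hw : ∀ i, w i ∈ Set.Ioo (0 : ℝ) 1) (hwsum : ¬ Summable w)
    (hsq : Summable fun i => w i ^ 2) (hfin : infKL k X f < ∞) {Ψ : ProbabilityMeasure S2}
    (hΨ : IsUniqueMinimizer k X f Ψ) :
    ∀ᵐ ω ∂Pr, WeaklyTo (pr k w Ψ₀ (fun i => Y i ω)) Ψ := by
  have := isProbabilityMeasure_law hf1
  obtain ⟨hΨX, hmin, huniq⟩ := hΨ
  have hΨ' := isMixing_coe.1 hΨX
  obtain ⟨c, hc⟩ : ∃ c : ℝ, ∀ Φ, IsMixing X Φ → 0 ≤ c - gain k (law f) Φ Ψ₀ ∧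
      KL f (mixture k Φ) = ENNReal.ofReal (c - gain k (law f) Φ Ψ₀) := by
    refine (KL_mixture_dichotomy hf hf' hf1 H hk_dens hΨ₀).resolve_left fun htop => ?_
    rw [← hmin, htop _ hΨ'] at hfin
    exact lt_irrefl _ hfin
  have hmax : ∀ Φ, IsMixing X Φ →
      gain k (law f) Φ Ψ₀ ≤ gain k (law f) (Ψ : Measure S2) Ψ₀ := fun Φ hΦ => by
    have h : KL f (mixture k (Ψ : Measure S2)) ≤ KL f (mixture k Φ) := by
      rw [hmin]
      exact iInf₂_le (⟨Φ, hΦ.isProbabilityMeasure⟩ : ProbabilityMeasure S2) hΦ.null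
    -- Nonnegativity of the real divergence makes the comparison survive `ENNReal.ofReal`.
    rw [(hc _ hΨ').2, (hc Φ hΦ).2, ENNReal.ofReal_le_ofReal_iff (hc Φ hΦ).1] at h
    linarith
  filter_upwards [H.ae_forall_mixture_pos hΨ₀ hY hlaw,
    H.ae_tendsto_gain_pr hΨ₀ hX hΨ' hmax hY hind hlaw hw hwsum hsq] with ω hω hlim
  have hm := H.isMixing_pr hΨ₀ hw hω
  refine ⟨fun n => ⟨pr k w Ψ₀ (fun i => Y i ω) n, (hm n).isProbabilityMeasure⟩, fun n => rfl,
    H.tendsto_of_tendsto_gain hΨ₀ (fun n => (hm n).null) (fun Φ hΦ h => huniq Φ hΦ ?_) hlim⟩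
  rw [← hmin, (hc _ (isMixing_coe.1 hΦ)).2, (hc _ hΨ').2, h]

/-- Strict concavity determines the optimal mixture density only almost everywhere under the data
law, which is why identifiability is required relative to that law. -/
theorem exists_isUniqueMinimizer (hf : Measurable f) (hf' : ∀ y, f y ≠ ∞)
    (hf1 : ∫⁻ y, f y ∂surf = 1) (H : RegularKernel k X (law f) B)
    (hk_dens : ∀ x ∈ X, ∫⁻ y, (k y x : ℝ≥0∞) ∂surf = 1) (hΨ₀ : IsMixing X Ψ₀)
    (hid : Identifiable k X (law f)) (hfin : infKL k X f < ∞) :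
    ∃ Ψ : ProbabilityMeasure S2, IsUniqueMinimizer k X f Ψ := by
  have := isProbabilityMeasure_law hf1
  obtain ⟨Ψ, hΨ, hmax⟩ := H.exists_forall_gain_le hΨ₀
  have hΨ' := isMixing_coe.1 hΨ
  rcases KL_mixture_dichotomy hf hf' hf1 H hk_dens hΨ₀ with htop | ⟨c, hc⟩
  · rw [infKL_eq hΨ fun Φ hΦ => by rw [htop Φ hΦ]; exact le_top, htop _ hΨ'] at hfin
    exact absurd hfin (lt_irrefl _)
  · have hinf : infKL k X f = KL f (mixture k (Ψ : Measure S2)) := infKL_eq hΨ fun Φ hΦ => by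
      rw [(hc Φ hΦ).2, (hc _ hΨ').2]
      exact ENNReal.ofReal_le_ofReal (by linarith [hmax Φ hΦ])
    refine ⟨Ψ, hΨ, hinf.symm, fun Φ hΦ h => (hid Ψ hΨ Φ hΦ ?_).symm⟩
    have hΦ' := isMixing_coe.1 hΦ
    refine H.mixture_ae_eq_of_gain_eq hΨ₀ hΨ' hΦ' hmax ?_
    rw [hinf, (hc _ hΦ').2, (hc _ hΨ').2,
      ENNReal.ofReal_eq_ofReal_iff (hc _ hΦ').1 (hc _ hΨ').1] at h
    linarith

/-- The minimum is 0, and zero divergence forces equality of densities almost everywhere for the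
surface measure, so the usual identifiability suffices. -/
theorem isUniqueMinimizer_of_ae_eq (hf : Measurable f) (hf1 : ∫⁻ y, f y ∂surf = 1)
    (hk : Measurable (Function.uncurry k))
    (hk_dens : ∀ x ∈ X, ∫⁻ y, (k y x : ℝ≥0∞) ∂surf = 1)
    (hid : Identifiable k X surf) {Ψ : ProbabilityMeasure S2} (hΨ : Ψ ∈ mixing X)
    (h : f =ᵐ[surf] mixture k (Ψ : Measure S2)) :
    infKL k X f = 0 ∧ IsUniqueMinimizer k X f Ψ := by
  have h0 := KL_eq_zero_of_ae_eq hf1 h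
  have hinf : infKL k X f = 0 := le_antisymm (h0 ▸ iInf₂_le Ψ hΨ) zero_le
  refine ⟨hinf, hΨ, h0.trans hinf.symm, fun Φ hΦ hΦ0 => hid Φ hΦ Ψ hΨ ?_⟩
  exact (ae_eq_of_KL_eq_zero hf (measurable_mixture hk _) hf1
    (lintegral_mixture_eq_one hk hk_dens (isMixing_coe.1 hΦ)) (hΦ0.trans hinf)).symm.trans h

end

theorem theorem1 {Ω : Type*} [MeasurableSpace Ω] (Pr : Measure Ω) [IsProbabilityMeasure Pr]
    -- the true density, and the iid data
    (fstar : S2 → ℝ≥0) (hf_meas : Measurable fstar)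
    (hf_dens : ∫⁻ y, (fstar y : ℝ≥0∞) ∂surf = 1)
    (Y : ℕ → Ω → S2) (hY_meas : ∀ i, Measurable (Y i)) (hY_indep : iIndepFun Y Pr)
    (hY_law : ∀ i, Pr.map (Y i) = law (fun y => fstar y))
    -- the initial guess; its support is the space of the mixing distributions
    (X : Set S2) (Ψ₀ : ProbabilityMeasure S2) (hX : (Ψ₀ : Measure S2).support = X)
    -- the kernel
    (k : S2 → S2 → ℝ≥0) (hk_meas : Measurable (Function.uncurry k))
    (hk_dens : ∀ x ∈ X, ∫⁻ y, (k y x : ℝ≥0∞) ∂surf = 1)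
    (hk_cont : ∀ y, ContinuousOn (k y) X)
    (hk_pos : ∀ x ∈ X, ∀ᵐ y ∂(law (fun y => fstar y)), 0 < k y x)
    (hk_int : (⨆ x₁ ∈ X, ⨆ x₂ ∈ X,
      ∫⁻ y, ((k y x₁ : ℝ≥0∞) / (k y x₂ : ℝ≥0∞)) ^ 2 * (fstar y : ℝ≥0∞) ∂surf) < ∞)
    -- the weights
    (w : ℕ → ℝ) (hw : ∀ i, w i ∈ Set.Ioo (0 : ℝ) 1)
    (hw_sum : ¬ Summable w) (hw_sq : Summable (fun i => w i ^ 2)) :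
    -- convergence of the mixture density estimates
    (∀ᵐ ω ∂Pr, Tendsto
      (fun n => KL (fun y => fstar y) (mixture k (pr k w Ψ₀ (fun i => Y i ω) n)))
      atTop (𝓝 (infKL k X (fun y => fstar y)))) ∧
    -- consistency of the mixture density estimates in a correctly specified model
    ((∃ Ψ ∈ mixing X, (fun y => (fstar y : ℝ≥0∞)) =ᵐ[surf] mixture k (Ψ : Measure S2)) →
      infKL k X (fun y => fstar y) = 0 ∧
      ∀ᵐ ω ∂Pr, Tendsto
        (fun n => ∫⁻ y, ENNReal.ofReal
          |(mixture k (pr k w Ψ₀ (fun i => Y i ω) n) y).toReal - (fstar y : ℝ)| ∂surf)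
        atTop (𝓝 0)) ∧
    -- convergence of the mixing distribution estimates
    (Identifiable k X (law (fun y => fstar y)) → infKL k X (fun y => fstar y) < ∞ →
      ∃ Ψstar : ProbabilityMeasure S2, IsUniqueMinimizer k X (fun y => fstar y) Ψstar ∧
        ∀ᵐ ω ∂Pr, WeaklyTo (pr k w Ψ₀ (fun i => Y i ω)) Ψstar) ∧
    -- consistency of the mixing distribution estimates in a correctly specified model
    (Identifiable k X surf → ∀ Ψtrue ∈ mixing X,
      (fun y => (fstar y : ℝ≥0∞)) =ᵐ[surf] mixture k (Ψtrue : Measure S2) →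
      IsUniqueMinimizer k X (fun y => fstar y) Ψtrue ∧
        ∀ᵐ ω ∂Pr, WeaklyTo (pr k w Ψ₀ (fun i => Y i ω)) Ψtrue) := by
  have hf : Measurable fun y => (fstar y : ℝ≥0∞) := hf_meas.coe_nnreal_ennreal
  have hf' : ∀ y, (fstar y : ℝ≥0∞) ≠ ∞ := fun y => ENNReal.coe_ne_top
  have hprob := isProbabilityMeasure_law hf_dens
  have hΨ₀ : IsMixing X (Ψ₀ : Measure S2) :=
    ⟨inferInstance, by rw [← hX]; exact Measure.measure_compl_support⟩
  set S := ⨆ x₁ ∈ X, ⨆ x₂ ∈ X,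
      ∫⁻ y, ((k y x₁ : ℝ≥0∞) / (k y x₂ : ℝ≥0∞)) ^ 2 * (fstar y : ℝ≥0∞) ∂surf
  -- The supremum of the moments, finite by assumption, serves as the uniform constant; a support is
  -- closed.
  have H : RegularKernel k X (law fun y => fstar y) S.toNNReal := by
    refine ⟨hX ▸ Measure.isClosed_support, hk_meas, hk_cont, hk_pos, fun x₁ h₁ x₂ h₂ => ?_⟩
    have hm : ∀ x, Measurable fun y => (k y x : ℝ≥0∞) := fun x =>
      (hk_meas.comp measurable_prodMk_right).coe_nnreal_ennreal
    have hr : Measurable fun y => ((k y x₁ : ℝ≥0∞) / (k y x₂ : ℝ≥0∞)) ^ 2 :=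
      ((hm x₁).div (hm x₂)).pow_const 2
    rw [law, lintegral_withDensity_eq_lintegral_mul _ hf hr, ENNReal.coe_toNNReal hk_int.ne]
    simp only [Pi.mul_apply, mul_comm (fstar _ : ℝ≥0∞)]
    exact le_iSup₂_of_le x₁ h₁ (le_iSup₂_of_le x₂ h₂ le_rfl)
  have hKL := ae_tendsto_KL_pr hf hf' hf_dens H hk_dens hΨ₀ hX hY_meas hY_indep hY_law hw hw_sum
    hw_sq
  refine ⟨hKL, ?_, ?_, ?_⟩
  · rintro ⟨Ψ, hΨ, h⟩
    have hinf : infKL k X (fun y => fstar y) = 0 :=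
      le_antisymm ((KL_eq_zero_of_ae_eq hf_dens h) ▸ iInf₂_le Ψ hΨ) zero_le
    refine ⟨hinf, ?_⟩
    filter_upwards [hKL, H.ae_forall_mixture_pos hΨ₀ hY_meas hY_law] with ω hlim hω
    rw [hinf] at hlim
    refine tendsto_zero_of_le_mul_add hlim fun n t ht => ?_
    have hm := H.isMixing_pr hΨ₀ hw hω n
    have := hm.isProbabilityMeasure
    exact lintegral_abs_sub_le_KL hf (measurable_mixture hk_meas _) hf' (H.mixture_ne_top hm)
      hf_dens (lintegral_mixture_eq_one hk_meas hk_dens hm) (H.ae_mixture_pos hm) ht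
  · intro hid hfin
    obtain ⟨Ψ, hΨ⟩ := exists_isUniqueMinimizer hf hf' hf_dens H hk_dens hΨ₀ hid hfin
    exact ⟨Ψ, hΨ, ae_weaklyTo_pr hf hf' hf_dens H hk_dens hΨ₀ hX hY_meas hY_indep hY_law hw hw_sum
      hw_sq hfin hΨ⟩
  · intro hid Ψ hΨ h
    obtain ⟨hinf, hun⟩ := isUniqueMinimizer_of_ae_eq hf hf_dens hk_meas hk_dens hid hΨ h
    exact ⟨hun, ae_weaklyTo_pr hf hf' hf_dens H hk_dens hΨ₀ hX hY_meas hY_indep hY_law hw hw_sum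
      hw_sq (by simp [hinf]) hun⟩
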